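/- **Theorem (spatial Reynolds transport theorem).** Let $W\subseteq\mathbb R^3$ be an open set of positions $\mathbf x=(x_1,x_2,x_3)$. For each $\mathbf x\in W$ let $\mathcal D(\mathbf x)\subset\mathbb R^3$ be a bounded open set of velocities $\mathbf u=(u_1,u_2,u_3)$ with $C^1$ boundary (locally on one side of its boundary), and let $\mathbf n_S$ be its outward unit normal and $dS$ the area element on $\partial\mathcal D(\mathbf x)$. Let $b(\mathbf u,\mathbf x)$ be a (time-independent) density with values in $\mathbb R$, or in a finite-dimensional real vector space, and let $\mathbf G_{rel}(\mathbf u,\mathbf x)$ be a $3\times3$ tensor field. Suppose that $b$ and $\mathbf G_{rel}$ are continuously differentiable in $(\mathbf u,\mathbf x)$ in a neighbourhood of every point $(\mathbf u,\mathbf x)$ with $\mathbf x\in W$ and $\mathbf u\in\overline{\mathcal D(\mathbf x)}$. Suppose that $\mathbf G_{rel}$ moves the domain in velocity space, in the following sense: there are a reference position $\mathbf x_0\in W$ and a map $\boldsymbol\varphi(\mathbf u_0,\mathbf x)$, continuously differentiable in a neighbourhood of every point of $\overline{\mathcal D(\mathbf x_0)}\times W$, such that $\boldsymbol\varphi(\mathbf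 u_0,\mathbf x_0)=\mathbf u_0$ for $\mathbf u_0\in\mathcal D(\mathbf x_0)$; for every $\mathbf x\in W$ the map $\boldsymbol\varphi(\cdot,\mathbf x)$ is a bijection of $\mathcal D(\mathbf x_0)$ onto $\mathcal D(\mathbf x)$ with nonsingular Jacobian; and $$\frac{\partial\varphi_j}{\partial x_i}(\mathbf u_0,\mathbf x)=G_{rel,ij}\bigl(\boldsymbol\varphi(\mathbf u_0,\mathbf x),\mathbf x\bigr)\qquad(\mathbf u_0\in\mathcal D(\mathbf x_0),\ \mathbf x\in W,\ i,j=1,2,3).$$ Then all the integrals below exist, the function $\mathbf x\mapsto\int_{\mathcal D(\mathbf x)}b\,d^3\mathbf u$ is (totally) differentiable on $W$, and its differential is $$d\int_{\mathcal D(\mathbf x)} b\,d^3\mathbf u=\Bigl[\int_{\mathcal D(\mathbf x)}\nabla_{\mathbf x}b\,d^3\mathbf u+\oint_{\partial\mathcal D(\mathbf x)}b\,\mathbf G_{rel}^\top\cdot d^2\mathbf u\Bigr]\cdot d\mathbf x=\Bigl[\int_{\mathcal D(\mathbf x)}\bigl(\nabla_{\mathbf x}b+\nabla_{\mathbf u}\cdot(b\,\mathbf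 G_{rel}^\top)\bigr)d^3\mathbf u\Bigr]\cdot d\mathbf x .$$ Here $\mathbf G_{rel}^\top\cdot d^2\mathbf u=\mathbf G_{rel}\,\mathbf n_S\,dS$, and $\nabla_{\mathbf u}\cdot(b\,\mathbf G_{rel}^\top)$ is the vector with $i$-th component $\sum_{j=1}^3\partial(b\,G_{rel,ij})/\partial u_j$. -/

import Mathlib

open Set Filter Topology MeasureTheory
open scoped MeasureTheory

noncomputable section

/-- Three-dimensional Euclidean space: both the position space and the velocity space. -/
abbrev E3 : Type := EuclideanSpace ℝ (Fin 3)

/-- The `i`-th standard unit vector. -/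
abbrev unitVec (i : Fin 3) : E3 := EuclideanSpace.single i 1

/-! ### Domains with continuously differentiable boundary -/

/-- `ρ` is a `C¹` defining function of the set `Ω` near the point `p`: it has a nonzero gradient
at `p`, and near `p` the set `Ω` is the sublevel set `{ρ < 0}`. -/
def IsDefiningFunctionAt (Ω : Set E3) (ρ : E3 → ℝ) (p : E3) : Prop :=
  ContDiffAt ℝ 1 ρ p ∧ gradient ρ p ≠ 0 ∧ ∀ᶠ u in 𝓝 p, (u ∈ Ω ↔ ρ u < 0)

/-- A bounded open set (lying locally on one side of its boundary) with `C¹` boundary. -/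
structure IsC1Domain (Ω : Set E3) : Prop where
  isOpen : IsOpen Ω
  isBounded : Bornology.IsBounded Ω
  boundary : ∀ p ∈ frontier Ω, ∃ ρ : E3 → ℝ, IsDefiningFunctionAt Ω ρ p

open Classical in
/-- The outward unit normal of `Ω` at `p`: the normalized gradient of a defining function.
It does not depend on the defining function, see `outwardUnitNormal_eq`. -/
def outwardUnitNormal (Ω : Set E3) (p : E3) : E3 :=
  if h : ∃ ρ : E3 → ℝ, IsDefiningFunctionAt Ω ρ p then
    ‖gradient h.choose p‖⁻¹ • gradient h.choose p
  else 0

/-- The (vector-valued) surface integral of `f` over the boundary of `Ω`, with respect to surface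
area, that is, two-dimensional Hausdorff measure normalized to agree with area in the plane. -/
def boundaryIntegral {F : Type*} [NormedAddCommGroup F] [NormedSpace ℝ F]
    (Ω : Set E3) (f : E3 → F) : F :=
  ∫ u in frontier Ω, f u ∂(μHE[2] : Measure E3)

/-! ### Vector calculus in position space and in velocity space -/

section calculus

variable {F : Type*} [NormedAddCommGroup F] [NormedSpace ℝ F]

/-- The `i`-th component of the spatial gradient `∇ₓ b` at `(u, x)`. -/
def gradX (b : E3 → E3 → F) (u x : E3) (i : Fin 3) : F :=
  fderiv ℝ (fun y => b u y) x (unitVec i)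

/-- The `i`-th component of `b Gᵀ · n = b G n`. -/
def flux (b : E3 → E3 → F) (G : E3 → E3 → Matrix (Fin 3) (Fin 3) ℝ) (n : E3) (u x : E3)
    (i : Fin 3) : F :=
  (∑ j, G u x i j * n j) • b u x

/-- The `i`-th component of the velocity divergence `∇ᵤ · (b Gᵀ) = [∇ᵤᵀ (b Gᵀ)]ᵀ`. -/
def divU (b : E3 → E3 → F) (G : E3 → E3 → Matrix (Fin 3) (Fin 3) ℝ) (u x : E3)
    (i : Fin 3) : F :=
  ∑ j, fderiv ℝ (fun v => G v x i j • b v x) u (unitVec j)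

/-- The linear form `c · dx = ∑ᵢ cᵢ dxᵢ` with coefficients `c`. -/
def dotDx (c : Fin 3 → F) : E3 →L[ℝ] F :=
  ∑ i, (EuclideanSpace.proj i : E3 →L[ℝ] ℝ).smulRight (c i)

end calculus

/-! ### Velocity domains moved by a velocity gradient tensor field -/

/-- The tensor field `G` moves the velocity domains `D x`, where `x` runs through the set `W` of
positions.  Here `φ u₀ x` is the velocity at position `x` that is connected, along the field `G`,
with the velocity `u₀` at the reference position `x₀`.  The map is `C¹` up to the boundary; for
each `x`, it is an injective map with nonsingular Jacobian of `D x₀` onto `D x`, and its spatial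
gradient is `∂φⱼ/∂xᵢ = Gᵢⱼ`. -/
structure MovesDomain (W : Set E3) (D : E3 → Set E3)
    (G : E3 → E3 → Matrix (Fin 3) (Fin 3) ℝ) (x₀ : E3) (φ : E3 → E3 → E3) : Prop where
  reference : ∀ u₀ ∈ D x₀, φ u₀ x₀ = u₀
  contDiffAt : ∀ x ∈ W, ∀ u₀ ∈ closure (D x₀),
    ContDiffAt ℝ 1 (fun p : E3 × E3 => φ p.1 p.2) (u₀, x)
  image_eq : ∀ x ∈ W, (fun u₀ => φ u₀ x) '' D x₀ = D x
  injOn : ∀ x ∈ W, InjOn (fun u₀ => φ u₀ x) (D x₀)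
  jacobian_ne_zero : ∀ x ∈ W, ∀ u₀ ∈ D x₀, (fderiv ℝ (fun v => φ v x) u₀).det ≠ 0
  gradient_eq : ∀ x ∈ W, ∀ u₀ ∈ D x₀, ∀ i j,
    (fderiv ℝ (fun y => φ u₀ y) x (unitVec i)) j = G (φ u₀ x) x i j

/-! ### The outward unit normal is well defined -/

theorem IsDefiningFunctionAt.eq_zero {Ω : Set E3} {ρ : E3 → ℝ} {p : E3}
    (h : IsDefiningFunctionAt Ω ρ p) (hΩ : IsOpen Ω) (hp : p ∈ frontier Ω) : ρ p = 0 := by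
  obtain ⟨hρ, -, hev⟩ := h
  rw [hΩ.frontier_eq] at hp
  have h1 : ¬ ρ p < 0 := fun hlt => hp.2 (hev.self_of_nhds.2 hlt)
  have h2 : ρ p ≤ 0 := by
    have hfreq : ∃ᶠ u in 𝓝 p, u ∈ Ω := mem_closure_iff_frequently.1 hp.1
    refine le_of_not_gt fun hgt => hfreq ?_
    filter_upwards [hρ.continuousAt.eventually (lt_mem_nhds hgt), hev] with u hu hu' hmem
    exact absurd (hu'.1 hmem) (not_lt.2 hu.le)
  linarith

theorem IsDefiningFunctionAt.inner_nonpos {Ω : Set E3} {ρ σ : E3 → ℝ} {p v : E3}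
    (h : IsDefiningFunctionAt Ω ρ p) (h' : IsDefiningFunctionAt Ω σ p) (hΩ : IsOpen Ω)
    (hp : p ∈ frontier Ω) (hv : inner ℝ (gradient ρ p) v < 0) :
    inner ℝ (gradient σ p) v ≤ 0 := by
  have key : ∀ {τ : E3 → ℝ}, IsDefiningFunctionAt Ω τ p →
      HasDerivAt (fun t : ℝ => τ (p + t • v)) (inner ℝ (gradient τ p) v) 0 := by
    intro τ hτ
    have hd : DifferentiableAt ℝ τ p := hτ.1.differentiableAt (by norm_num)
    have hg := hd.hasGradientAt.hasFDerivAt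
    have hl : HasDerivAt (fun t : ℝ => p + t • v) v 0 := by
      simpa using ((hasDerivAt_id (0 : ℝ)).smul_const v).const_add p
    have hg' : HasFDerivAt τ ((InnerProductSpace.toDual ℝ E3) (gradient τ p))
        (p + (0 : ℝ) • v) := by simpa using hg
    have hc := hg'.comp_hasDerivAt (0 : ℝ) hl
    rwa [InnerProductSpace.toDual_apply_apply] at hc
  have hcont : Tendsto (fun t : ℝ => p + t • v) (𝓝 0) (𝓝 p) := by
    have : Continuous fun t : ℝ => p + t • v := by fun_prop
    simpa using this.tendsto 0
  by_contra! hpos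
  have e1 := (key h).tendsto_slope
  have e2 := (key h').tendsto_slope
  have e1' := e1.eventually (gt_mem_nhds hv)
  have e2' := e2.eventually (lt_mem_nhds hpos)
  have le : 𝓝[>] (0 : ℝ) ≤ 𝓝[≠] 0 := nhdsWithin_mono _ fun t ht => ne_of_gt ht
  have e3 := (hcont.eventually h.2.2).filter_mono (nhdsWithin_le_nhds (s := Ioi (0 : ℝ)))
  have e4 := (hcont.eventually h'.2.2).filter_mono (nhdsWithin_le_nhds (s := Ioi (0 : ℝ)))
  obtain ⟨t, ht1, ht2, ht3, ht4, ht0⟩ :=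
    ((e1'.filter_mono le).and ((e2'.filter_mono le).and
      (e3.and (e4.and self_mem_nhdsWithin)))).exists
  have ht0' : (0 : ℝ) < t := ht0
  simp only [slope_def_field, zero_smul, add_zero, sub_zero, h.eq_zero hΩ hp,
    h'.eq_zero hΩ hp] at ht1 ht2
  have a1 : ρ (p + t • v) < 0 := by
    by_contra! hc
    exact absurd ht1 (not_lt.2 (div_nonneg hc ht0'.le))
  have a2 : σ (p + t • v) < 0 := ht4.1 (ht3.2 a1)
  exact absurd ht2 (not_lt.2 (div_nonpos_of_nonpos_of_nonneg a2.le ht0'.le))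

theorem normalize_eq_of_inner {a c : E3} (ha : a ≠ 0) (hc : c ≠ 0)
    (h : ∀ v, inner ℝ a v < 0 → inner ℝ c v ≤ 0) : ‖a‖⁻¹ • a = ‖c‖⁻¹ • c := by
  have ha' : 0 < ‖a‖ := norm_pos_iff.2 ha
  have hc' : 0 < ‖c‖ := norm_pos_iff.2 hc
  have hle : ∀ v, inner ℝ a v ≤ 0 → inner ℝ c v ≤ 0 := by
    intro v hv
    refine le_of_forall_pos_le_add fun ε hε => ?_
    by_cases hca : inner ℝ c a = 0
    · have := h (v - a) (by
        rw [inner_sub_right, real_inner_self_eq_norm_sq]; nlinarith [pow_pos ha' 2])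
      rw [inner_sub_right, hca] at this
      linarith
    · have hpos : 0 < |inner ℝ c a| := abs_pos.2 hca
      have := h (v - (ε / |inner ℝ c a|) • a) (by
        rw [inner_sub_right, inner_smul_right, real_inner_self_eq_norm_sq]
        have : 0 < ε / |inner ℝ c a| * ‖a‖ ^ 2 := by positivity
        linarith)
      rw [inner_sub_right, inner_smul_right] at this
      have h2 : ε / |inner ℝ c a| * inner ℝ c a ≤ ε := by
        calc ε / |inner ℝ c a| * inner ℝ c a ≤ ε / |inner ℝ c a| * |inner ℝ c a| := by
              gcongr; exact le_abs_self _
          _ = ε := div_mul_cancel₀ _ hpos.ne'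
      linarith
  -- test the implication on `‖a‖ c - ‖c‖ a`
  have h1 := hle (‖a‖ • c - ‖c‖ • a)
  rw [inner_sub_right, inner_sub_right, inner_smul_right, inner_smul_right, inner_smul_right,
    inner_smul_right, real_inner_self_eq_norm_sq, real_inner_self_eq_norm_sq,
    real_inner_comm a c] at h1
  have hcs : inner ℝ a c ≤ ‖a‖ * ‖c‖ := real_inner_le_norm a c
  have h2 := h1 (by nlinarith)
  have h3 : ‖a‖ * ‖c‖ ≤ inner ℝ a c := by
    have : ‖c‖ * (‖a‖ * ‖c‖) ≤ ‖c‖ * inner ℝ a c := by nlinarith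
    exact le_of_mul_le_mul_left this hc'
  have h4 : inner ℝ a c = ‖a‖ * ‖c‖ := le_antisymm hcs h3
  rw [inner_eq_norm_mul_iff_real] at h4
  -- `h4 : ‖c‖ • a = ‖a‖ • c`
  have : a = (‖c‖⁻¹ * ‖a‖) • c := by
    rw [mul_smul, ← h4, smul_smul, inv_mul_cancel₀ hc'.ne', one_smul]
  calc ‖a‖⁻¹ • a = ‖a‖⁻¹ • ((‖c‖⁻¹ * ‖a‖) • c) := by rw [← this]
    _ = ‖c‖⁻¹ • c := by
      rw [smul_smul]; congr 1; field_simp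

theorem outwardUnitNormal_eq {Ω : Set E3} {ρ : E3 → ℝ} {p : E3} (hΩ : IsOpen Ω)
    (hp : p ∈ frontier Ω) (h : IsDefiningFunctionAt Ω ρ p) :
    outwardUnitNormal Ω p = ‖gradient ρ p‖⁻¹ • gradient ρ p := by
  have hex : ∃ ρ : E3 → ℝ, IsDefiningFunctionAt Ω ρ p := ⟨ρ, h⟩
  rw [outwardUnitNormal, dif_pos hex]
  exact normalize_eq_of_inner hex.choose_spec.2.1 h.2.1
    fun v hv => hex.choose_spec.inner_nonpos h hΩ hp hv

end

/-! The integral over `D y` is pulled back by `φ(·, y)` to the fixed domain `D x₀`, where it can be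
differentiated under the integral sign. The Jacobian matrix of `φ(·, y)` is differentiable in `y`,
although `φ` is only `C¹`, because the spatial gradient of `φ` is the `C¹` function `G(φ, y)` of
both variables (`hasFDerivAt_fderiv_of_hasStrictFDerivAt`); its derivative is `∇ᵤ G` times the
Jacobian matrix, so the determinant satisfies Liouville's formula
(`HasFDerivAt.det_of_eq_comp`) and the transported integrand has the derivative
`|J| (∇ₓ b + ∇ᵤ · (b Gᵀ))` (`hasFDerivAt_abs_jacobian_smul_comp`). Changing variables back gives the
volume form of the theorem (`MovesDomain.hasFDerivAt_setIntegral`).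

The surface form follows by the divergence theorem on a `C¹` domain, with two-dimensional Hausdorff
measure on the boundary (`IsC1Domain.setIntegral_fderiv_eq_boundaryIntegral`). Around a boundary
point `p` with normal `n`, the domain is the subgraph over the tangent plane of a function `g` whose
derivative is as small as desired (`IsC1Domain.exists_local_graph`). Three things are then true up
to a relative error `ε`: the flux through the graph is the flux in direction `n` through the plane
below (`setIntegral_subgraph_fderiv`, a shear and Fubini), the area of the graph is the area of its
projection (the graph map and the projection are almost isometric), and the normal is `n`. So the
divergence theorem holds up to a relative error `ε` for functions with small support
(`IsC1Domain.exists_frontier_patch`). A partition of unity adds the patches up with total error at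
most `ε` times the integral of `‖f‖` over the boundary, and `ε` tends to zero. In this way the area
formula for graphs is not needed. -/

/-! ### Interchanging the derivatives of a map with prescribed spatial derivative -/

/-- If the derivative of `φ` in the second variable is a function `A` that is strictly
differentiable in both variables, then the derivative of `φ` in the first variable can be
differentiated in the second one, although `φ` itself need not be twice differentiable. -/
theorem hasFDerivAt_fderiv_of_hasStrictFDerivAt {E X E' : Type*}
    [NormedAddCommGroup E] [NormedSpace ℝ E] [NormedAddCommGroup X] [NormedSpace ℝ X]
    [NormedAddCommGroup E'] [NormedSpace ℝ E']
    {φ : E → X → E'} {A : E × X → X →L[ℝ] E'} {A' : E × X →L[ℝ] X →L[ℝ] E'} {u₀ : E} {x₀ : X}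
    (hφ : ∀ᶠ p : E × X in 𝓝 (u₀, x₀), HasFDerivAt (φ p.1) (A p) p.2)
    (hφu : ∀ᶠ y in 𝓝 x₀, DifferentiableAt ℝ (fun u => φ u y) u₀)
    (hA : HasStrictFDerivAt A A' (u₀, x₀)) :
    HasFDerivAt (fun y => fderiv ℝ (fun u => φ u y) u₀)
      (A' ∘L ContinuousLinearMap.inl ℝ E X).flip x₀ := by
  rw [hasFDerivAt_iff_isLittleO, Asymptotics.isLittleO_iff]
  intro ε hε
  have hA₂ := hA.isLittleO.bound (half_pos hε)
  obtain ⟨r, hr, hball⟩ := Metric.eventually_nhds_iff_ball.1 hφ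
  obtain ⟨s, hs, hball'⟩ := Metric.eventually_nhds_iff_ball.1 hA₂
  set δ := min r s
  have hδ : 0 < δ := lt_min hr hs
  have hmem : ∀ {u : E} {y : X}, u ∈ Metric.ball u₀ δ → y ∈ Metric.ball x₀ δ →
      (u, y) ∈ Metric.ball (u₀, x₀) δ := by
    intro u y hu hy
    rw [← ball_prod_same]
    exact ⟨hu, hy⟩
  have hest : ∀ {u u' : E} {y : X}, u ∈ Metric.ball u₀ δ → u' ∈ Metric.ball u₀ δ →
      y ∈ Metric.ball x₀ δ → ‖A (u, y) - A (u', y) - A' (u - u', 0)‖ ≤ ε / 2 * ‖u - u'‖ := by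
    intro u u' y hu hu' hy
    have hp : ((u, y), (u', y)) ∈ Metric.ball ((u₀, x₀), (u₀, x₀)) s := by
      rw [← ball_prod_same]
      exact ⟨Metric.ball_subset_ball (min_le_right _ _) (hmem hu hy),
        Metric.ball_subset_ball (min_le_right _ _) (hmem hu' hy)⟩
    have := hball' _ hp
    simpa [Prod.norm_def] using this
  filter_upwards [Metric.ball_mem_nhds x₀ hδ, hφu] with y hy hdy
  have hx₀ : x₀ ∈ Metric.ball x₀ δ := Metric.mem_ball_self hδ
  have hu₀ : u₀ ∈ Metric.ball u₀ δ := Metric.mem_ball_self hδ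
  have hφ' : ∀ {u : E} {z : X}, u ∈ Metric.ball u₀ δ → z ∈ Metric.ball x₀ δ →
      HasFDerivAt (φ u) (A (u, z)) z := fun hu hz =>
    hball _ (Metric.ball_subset_ball (min_le_left _ _) (hmem hu hz))
  have hdx : DifferentiableAt ℝ (fun u => φ u x₀) u₀ := hφu.self_of_nhds
  have hAd : HasFDerivAt (fun u => A (u, x₀)) (A' ∘L ContinuousLinearMap.inl ℝ E X) u₀ :=
    hA.hasFDerivAt.comp u₀ (hasFDerivAt_prodMk_left u₀ x₀)
  have hd : HasFDerivAt (fun u => φ u y - φ u x₀ - A (u, x₀) (y - x₀))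
      (fderiv ℝ (fun u => φ u y) u₀ - fderiv ℝ (fun u => φ u x₀) u₀
        - (A' ∘L ContinuousLinearMap.inl ℝ E X).flip (y - x₀)) u₀ := by
    refine (hdy.hasFDerivAt.sub hdx.hasFDerivAt).sub ?_
    exact (hAd.clm_apply (hasFDerivAt_const (y - x₀) u₀)).congr_fderiv (by ext; simp)
  refine hd.le_of_lip' (by positivity) ?_
  filter_upwards [Metric.ball_mem_nhds u₀ hδ] with u hu
  -- mean value inequality in `y` for the difference of the maps `φ u` and `φ u₀`
  have hmv := (convex_ball x₀ δ).norm_image_sub_le_of_norm_hasFDerivWithin_le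
    (f := fun z => φ u z - φ u₀ z - (A (u, x₀) - A (u₀, x₀)) z)
    (f' := fun z => A (u, z) - A (u₀, z) - (A (u, x₀) - A (u₀, x₀)))
    (C := ε * ‖u - u₀‖)
    (fun z hz => (((hφ' hu hz).sub (hφ' hu₀ hz)).sub
      (A (u, x₀) - A (u₀, x₀)).hasFDerivAt).hasFDerivWithinAt) ?_ hx₀ hy
  · calc _ = _ := by congr 1; simp only [map_sub, sub_apply]; abel
      _ ≤ _ := hmv
      _ = _ := by ring
  · intro z hz
    calc ‖A (u, z) - A (u₀, z) - (A (u, x₀) - A (u₀, x₀))‖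
        = ‖(A (u, z) - A (u₀, z) - A' (u - u₀, 0))
            - (A (u, x₀) - A (u₀, x₀) - A' (u - u₀, 0))‖ := by congr 1; abel
      _ ≤ ε / 2 * ‖u - u₀‖ + ε / 2 * ‖u - u₀‖ :=
        (norm_sub_le _ _).trans (add_le_add (hest hu hu₀ hz) (hest hu hu₀ hx₀))
      _ = ε * ‖u - u₀‖ := by ring

/-! ### The derivative of a Jacobian determinant -/

theorem EuclideanSpace.det_eq_det_toMatrix (L : E3 →L[ℝ] E3) :
    L.det = (Matrix.of fun i j => L (unitVec j) i).det := by
  rw [ContinuousLinearMap.det,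
    ← LinearMap.det_toMatrix (EuclideanSpace.basisFun (Fin 3) ℝ).toBasis]
  congr 1

theorem E3.eq_sum_unitVec (v : E3) : v = ∑ k, v k • unitVec k := by
  ext i
  simp [Finset.sum_apply, Pi.single_apply]

/-- Jacobi's formula in Liouville's form: if `M' = B ∘ M`, then `(det M)' = tr B · det M`. -/
theorem HasFDerivAt.det_of_eq_comp {X : Type*} [NormedAddCommGroup X] [NormedSpace ℝ X]
    {M : X → E3 →L[ℝ] E3} {M' : X →L[ℝ] E3 →L[ℝ] E3} {B : X →L[ℝ] E3 →L[ℝ] E3} {x : X}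
    (hM : HasFDerivAt M M' x) (hB : ∀ h, M' h = B h ∘L M x) (T : X →L[ℝ] ℝ)
    (hT : ∀ h, T h = ∑ j, (B h (unitVec j)) j) :
    HasFDerivAt (fun y => (M y).det) ((M x).det • T) x := by
  have hentry : ∀ i j, HasFDerivAt (fun y => (M y (unitVec j)) i)
      ((EuclideanSpace.proj i : E3 →L[ℝ] ℝ) ∘L M'.flip (unitVec j)) x := by
    intro i j
    have := (EuclideanSpace.proj i : E3 →L[ℝ] ℝ).hasFDerivAt.comp x
      (hM.clm_apply (hasFDerivAt_const (unitVec j) x))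
    exact this.congr_fderiv (by ext; simp)
  have hprod : ∀ i j h, (M' h (unitVec j)) i =
      ∑ k, (B h (unitVec k)) i * (M x (unitVec j)) k := by
    intro i j h
    rw [hB, ContinuousLinearMap.comp_apply]
    conv_lhs => rw [E3.eq_sum_unitVec (M x (unitVec j))]
    simp [map_sum, mul_comm]
  simp only [EuclideanSpace.det_eq_det_toMatrix, Matrix.det_fin_three, Matrix.of_apply]
  have hd := (((((((hentry 0 0).mul (hentry 1 1)).mul (hentry 2 2)).sub
    (((hentry 0 0).mul (hentry 1 2)).mul (hentry 2 1))).sub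
    (((hentry 0 1).mul (hentry 1 0)).mul (hentry 2 2))).add
    (((hentry 0 1).mul (hentry 1 2)).mul (hentry 2 0))).add
    (((hentry 0 2).mul (hentry 1 0)).mul (hentry 2 1))).sub
    (((hentry 0 2).mul (hentry 1 1)).mul (hentry 2 0))
  refine hd.congr_fderiv ?_
  ext h
  have hp := fun i j => hprod i j h
  simp only [Fin.sum_univ_three] at hp
  simp only [sub_apply, add_apply,
    smul_apply, ContinuousLinearMap.comp_apply, smul_eq_mul,
    ContinuousLinearMap.flip_apply, PiLp.proj_apply, Pi.mul_apply, hT, Fin.sum_univ_three,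
    hp]
  ring

theorem HasFDerivAt.abs_of_eq_smul {X : Type*} [NormedAddCommGroup X] [NormedSpace ℝ X]
    {J : X → ℝ} {T : X →L[ℝ] ℝ} {x : X} (hJ : HasFDerivAt J (J x • T) x) (h0 : J x ≠ 0) :
    HasFDerivAt (fun y => |J y|) (|J x| • T) x := by
  refine ((hasDerivAt_abs h0).comp_hasFDerivAt x hJ).congr_fderiv ?_
  rw [smul_smul, sign_mul_self]

/-! ### Continuity of partial derivatives -/

section partialDerivatives

variable {E X F : Type*} [NormedAddCommGroup E] [NormedSpace ℝ E] [NormedAddCommGroup X]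
  [NormedSpace ℝ X] [NormedAddCommGroup F] [NormedSpace ℝ F] {f : E → X → F} {u : E} {x : X}

theorem DifferentiableAt.hasFDerivAt_partial_fst
    (h : DifferentiableAt ℝ (fun p : E × X => f p.1 p.2) (u, x)) :
    HasFDerivAt (fun v => f v x)
      (fderiv ℝ (fun p : E × X => f p.1 p.2) (u, x) ∘L ContinuousLinearMap.inl ℝ E X) u :=
  h.hasFDerivAt.comp (f := fun v => (v, x)) u (hasFDerivAt_prodMk_left u x)

theorem DifferentiableAt.hasFDerivAt_partial_snd
    (h : DifferentiableAt ℝ (fun p : E × X => f p.1 p.2) (u, x)) :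
    HasFDerivAt (fun y => f u y)
      (fderiv ℝ (fun p : E × X => f p.1 p.2) (u, x) ∘L ContinuousLinearMap.inr ℝ E X) x :=
  h.hasFDerivAt.comp (f := fun y => (u, y)) x (hasFDerivAt_prodMk_right u x)

theorem ContDiffAt.eventually_differentiableAt {f : E → F} {u : E} (h : ContDiffAt ℝ 1 f u) :
    ∀ᶠ v in 𝓝 u, DifferentiableAt ℝ f v :=
  (h.eventually (by simp)).mono fun _ hv => hv.differentiableAt (by simp)

theorem ContDiffAt.continuousAt_partial_fst
    (h : ContDiffAt ℝ 1 (fun p : E × X => f p.1 p.2) (u, x)) :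
    ContinuousAt (fun p : E × X => fderiv ℝ (fun v => f v p.2) p.1) (u, x) := by
  refine ((h.continuousAt_fderiv (by simp)).clm_comp continuousAt_const).congr (f := fun p =>
    fderiv ℝ (fun p : E × X => f p.1 p.2) p ∘L ContinuousLinearMap.inl ℝ E X) ?_
  filter_upwards [h.eventually_differentiableAt] with p hp
  exact hp.hasFDerivAt_partial_fst.fderiv.symm

theorem ContDiffAt.continuousAt_partial_snd
    (h : ContDiffAt ℝ 1 (fun p : E × X => f p.1 p.2) (u, x)) :
    ContinuousAt (fun p : E × X => fderiv ℝ (fun y => f p.1 y) p.2) (u, x) := by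
  refine ((h.continuousAt_fderiv (by simp)).clm_comp continuousAt_const).congr (f := fun p =>
    fderiv ℝ (fun p : E × X => f p.1 p.2) p ∘L ContinuousLinearMap.inr ℝ E X) ?_
  filter_upwards [h.eventually_differentiableAt] with p hp
  exact hp.hasFDerivAt_partial_snd.fderiv.symm

end partialDerivatives

/-! ### The spatial derivative of the transported integrand -/

section integrand

variable {F : Type*} [NormedAddCommGroup F] [NormedSpace ℝ F]

/-- The map `c ↦ c · dx` as a continuous linear map. -/
noncomputable def dotDxCLM (F : Type*) [NormedAddCommGroup F] [NormedSpace ℝ F] :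
    (Fin 3 → F) →L[ℝ] E3 →L[ℝ] F :=
  ∑ i, (ContinuousLinearMap.smulRightL ℝ E3 F (EuclideanSpace.proj i)) ∘L
    (ContinuousLinearMap.proj i : (Fin 3 → F) →L[ℝ] F)

theorem dotDxCLM_apply (c : Fin 3 → F) : dotDxCLM F c = dotDx c := by
  ext v
  simp [dotDxCLM, dotDx]

theorem dotDx_unitVec (c : Fin 3 → F) (i : Fin 3) : dotDx c (unitVec i) = c i := by
  simp [dotDx]

theorem E3.clm_ext {L L' : E3 →L[ℝ] F} (h : ∀ i, L (unitVec i) = L' (unitVec i)) : L = L' := by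
  ext v
  rw [E3.eq_sum_unitVec v]
  simp [map_sum, h]

/-- The linear map `h ↦ Gᵀ h` with which a displacement `h` in position space changes the
velocity. -/
noncomputable def velocityChange (G : E3 → E3 → Matrix (Fin 3) (Fin 3) ℝ) (p : E3 × E3) :
    E3 →L[ℝ] E3 :=
  dotDx fun i => WithLp.toLp 2 (G p.1 p.2 i)

theorem velocityChange_unitVec_apply (G : E3 → E3 → Matrix (Fin 3) (Fin 3) ℝ) (p : E3 × E3)
    (i j : Fin 3) : velocityChange G p (unitVec i) j = G p.1 p.2 i j := by
  rw [velocityChange, dotDx_unitVec]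

theorem contDiffAt_velocityChange {G : E3 → E3 → Matrix (Fin 3) (Fin 3) ℝ} {p : E3 × E3}
    (hG : ∀ i j, ContDiffAt ℝ 1 (fun q : E3 × E3 => G q.1 q.2 i j) p) :
    ContDiffAt ℝ 1 (velocityChange G) p := by
  have : velocityChange G = fun q : E3 × E3 =>
      dotDxCLM E3 (fun i => WithLp.toLp 2 (G q.1 q.2 i)) := by
    ext1 q
    rw [dotDxCLM_apply, velocityChange]
  rw [this]
  refine (dotDxCLM E3).contDiff.contDiffAt.comp p (contDiffAt_pi.2 fun i => ?_)
  exact (contDiffAt_piLp 2).2 fun j => hG i j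

/-- The integrand after the change of variables `u = φ(u₀, y)` has the spatial derivative
`|J| (∇ₓ b + ∇ᵤ · (b Gᵀ)) · dx`, where `J` is the Jacobian of `φ(·, y)`. -/
theorem hasFDerivAt_abs_jacobian_smul_comp {b : E3 → E3 → F}
    {G : E3 → E3 → Matrix (Fin 3) (Fin 3) ℝ} {φ : E3 → E3 → E3} {u₀ y : E3}
    (hb : ContDiffAt ℝ 1 (fun p : E3 × E3 => b p.1 p.2) (φ u₀ y, y))
    (hG : ∀ i j, ContDiffAt ℝ 1 (fun p : E3 × E3 => G p.1 p.2 i j) (φ u₀ y, y))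
    (hφ : ContDiffAt ℝ 1 (fun p : E3 × E3 => φ p.1 p.2) (u₀, y))
    (hφG : ∀ᶠ p : E3 × E3 in 𝓝 (u₀, y), ∀ i j,
      (fderiv ℝ (fun z => φ p.1 z) p.2 (unitVec i)) j = G (φ p.1 p.2) p.2 i j)
    (hJ : (fderiv ℝ (fun v => φ v y) u₀).det ≠ 0) :
    HasFDerivAt (fun z => |(fderiv ℝ (fun v => φ v z) u₀).det| • b (φ u₀ z) z)
      (|(fderiv ℝ (fun v => φ v y) u₀).det| •
        dotDx fun i => gradX b (φ u₀ y) y i + divU b G (φ u₀ y) y i) y := by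
  have hA : ContDiffAt ℝ 1 (velocityChange G) (φ u₀ y, y) := contDiffAt_velocityChange hG
  have hφ₂ : ∀ᶠ p : E3 × E3 in 𝓝 (u₀, y),
      HasFDerivAt (φ p.1) (velocityChange G (φ p.1 p.2, p.2)) p.2 := by
    filter_upwards [hφ.eventually_differentiableAt, hφG] with p hp hpG
    have h := (DifferentiableAt.hasFDerivAt_partial_snd (f := φ) hp).differentiableAt.hasFDerivAt
    refine h.congr_fderiv (E3.clm_ext fun i => ?_)
    ext j
    rw [velocityChange_unitVec_apply]
    exact hpG i j
  have hφ₁ : ∀ᶠ z in 𝓝 y, DifferentiableAt ℝ (fun v => φ v z) u₀ := by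
    have hc : Tendsto (fun z : E3 => (u₀, z)) (𝓝 y) (𝓝 (u₀, y)) :=
      (Continuous.prodMk_right u₀).tendsto y
    filter_upwards [hc.eventually hφ.eventually_differentiableAt] with z hz
    exact (DifferentiableAt.hasFDerivAt_partial_fst (f := φ) hz).differentiableAt
  have hφy : HasFDerivAt (φ u₀) (velocityChange G (φ u₀ y, y)) y := hφ₂.self_of_nhds
  have hMy : HasFDerivAt (fun v => φ v y) (fderiv ℝ (fun v => φ v y) u₀) u₀ :=
    hφ₁.self_of_nhds.hasFDerivAt
  -- the composition of `velocityChange G` with `(u, z) ↦ (φ u z, z)`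
  have hÂ : ContDiffAt ℝ 1 (fun p : E3 × E3 => velocityChange G (φ p.1 p.2, p.2)) (u₀, y) :=
    ContDiffAt.comp (g := velocityChange G) (f := fun p : E3 × E3 => (φ p.1 p.2, p.2)) (u₀, y) hA
      (hφ.prodMk contDiffAt_snd)
  have hM := hasFDerivAt_fderiv_of_hasStrictFDerivAt hφ₂ hφ₁ (hÂ.hasStrictFDerivAt (by simp))
  have hA₁ := (DifferentiableAt.hasFDerivAt_partial_fst (f := fun u z => velocityChange G (u, z))
    (hA.differentiableAt (by simp))).differentiableAt.hasFDerivAt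
  have hA₂ := (DifferentiableAt.hasFDerivAt_partial_fst
    (f := fun u z => velocityChange G (φ u z, z)) (hÂ.differentiableAt (by simp)))
  have hcomp := hA₂.unique (HasFDerivAt.comp (g := fun v => velocityChange G (v, y))
    (f := fun v => φ v y) u₀ hA₁ hMy)
  set A₁ : E3 →L[ℝ] E3 →L[ℝ] E3 := fderiv ℝ (fun v => velocityChange G (v, y)) (φ u₀ y)
  have hdet := hM.det_of_eq_comp (B := A₁.flip)
    (T := ∑ j, (EuclideanSpace.proj j : E3 →L[ℝ] ℝ) ∘L A₁ (unitVec j))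
    (by intro h; rw [hcomp]; ext v; simp) (by intro h; simp)
  have habs := hdet.abs_of_eq_smul hJ
  have hbφ : HasFDerivAt (fun z => b (φ u₀ z) z)
      (fderiv ℝ (fun p : E3 × E3 => b p.1 p.2) (φ u₀ y, y) ∘L
        (velocityChange G (φ u₀ y, y)).prod (ContinuousLinearMap.id ℝ E3)) y :=
    HasFDerivAt.comp (g := fun p : E3 × E3 => b p.1 p.2) (f := fun z => (φ u₀ z, z)) y
      (hb.differentiableAt (by simp)).hasFDerivAt (hφy.prodMk (hasFDerivAt_id y))
  refine (habs.smul hbφ).congr_fderiv (E3.clm_ext fun i => ?_)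
  have hbu := DifferentiableAt.hasFDerivAt_partial_fst (f := b) (hb.differentiableAt (by simp))
  have hbx := DifferentiableAt.hasFDerivAt_partial_snd (f := b) (hb.differentiableAt (by simp))
  have hGu : ∀ j, HasFDerivAt (fun v => G v y i j)
      ((EuclideanSpace.proj j : E3 →L[ℝ] ℝ) ∘L A₁.flip (unitVec i)) (φ u₀ y) := by
    intro j
    have h := (EuclideanSpace.proj j : E3 →L[ℝ] ℝ).hasFDerivAt.comp (φ u₀ y)
      (hA₁.clm_apply (hasFDerivAt_const (unitVec i) (φ u₀ y)))
    refine (h.congr_fderiv (by ext; simp)).congr_of_eventuallyEq (.of_forall fun v => ?_)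
    exact (velocityChange_unitVec_apply G (v, y) i j).symm
  have hdiv : divU b G (φ u₀ y) y i =
      fderiv ℝ (fun p : E3 × E3 => b p.1 p.2) (φ u₀ y, y)
          (velocityChange G (φ u₀ y, y) (unitVec i), 0)
        + (∑ j, (A₁ (unitVec j) (unitVec i)) j) • b (φ u₀ y) y := by
    have hv : velocityChange G (φ u₀ y, y) (unitVec i) = ∑ j, G (φ u₀ y) y i j • unitVec j := by
      rw [E3.eq_sum_unitVec (velocityChange G (φ u₀ y, y) (unitVec i))]
      simp only [velocityChange_unitVec_apply]
    have hinl : ∀ w : E3, ((w, 0) : E3 × E3) = ContinuousLinearMap.inl ℝ E3 E3 w := fun _ => rfl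
    rw [hv, hinl, map_sum, map_sum, Finset.sum_smul, ← Finset.sum_add_distrib]
    refine Finset.sum_congr rfl fun j _ => ?_
    have hj : HasFDerivAt (fun v => G v y i j • b v y) _ (φ u₀ y) := (hGu j).smul hbu
    rw [hj.fderiv, map_smul, map_smul]
    simp
  have hsplit : (velocityChange G (φ u₀ y, y) (unitVec i), unitVec i)
      = (velocityChange G (φ u₀ y, y) (unitVec i), 0) + ((0, unitVec i) : E3 × E3) := by simp
  rw [smul_apply, dotDx_unitVec, hdiv, gradX, hbx.fderiv]
  simp only [add_apply, smul_apply, ContinuousLinearMap.comp_apply,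
    ContinuousLinearMap.smulRight_apply, ContinuousLinearMap.prod_apply,
    ContinuousLinearMap.id_apply, ContinuousLinearMap.inr_apply, sum_apply, PiLp.proj_apply]
  rw [hsplit, map_add]
  simp only [smul_add, smul_smul, smul_eq_mul]
  abel

end integrand

/-! ### Transport of integrals over moving domains -/

theorem Bornology.IsBounded.integrableOn_of_continuousAt_closure {F : Type*}
    [NormedAddCommGroup F] {Ω : Set E3}
    (hΩ : Bornology.IsBounded Ω) {f : E3 → F} (hf : ∀ u ∈ closure Ω, ContinuousAt f u) :
    IntegrableOn f Ω :=
  (ContinuousOn.integrableOn_compact hΩ.isCompact_closure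
    fun u hu => (hf u hu).continuousWithinAt).mono_set subset_closure

section transport

variable {F : Type*} [NormedAddCommGroup F] [NormedSpace ℝ F]

theorem continuousAt_gradX {b : E3 → E3 → F} {u x : E3}
    (hb : ContDiffAt ℝ 1 (fun p : E3 × E3 => b p.1 p.2) (u, x)) (i : Fin 3) :
    ContinuousAt (fun p : E3 × E3 => gradX b p.1 p.2 i) (u, x) :=
  (ContDiffAt.continuousAt_partial_snd (f := b) hb).clm_apply continuousAt_const

theorem continuousAt_divU {b : E3 → E3 → F} {G : E3 → E3 → Matrix (Fin 3) (Fin 3) ℝ} {u x : E3}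
    (hb : ContDiffAt ℝ 1 (fun p : E3 × E3 => b p.1 p.2) (u, x))
    (hG : ∀ i j, ContDiffAt ℝ 1 (fun p : E3 × E3 => G p.1 p.2 i j) (u, x)) (i : Fin 3) :
    ContinuousAt (fun p : E3 × E3 => divU b G p.1 p.2 i) (u, x) := by
  unfold divU
  refine tendsto_finsetSum _ fun j _ => ?_
  exact (ContDiffAt.continuousAt_partial_fst (f := fun v y => G v y i j • b v y)
    ((hG i j).smul hb)).clm_apply continuousAt_const

theorem MovesDomain.map_mem_closure {W : Set E3} {D : E3 → Set E3}
    {G : E3 → E3 → Matrix (Fin 3) (Fin 3) ℝ} {x₀ : E3} {φ : E3 → E3 → E3}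
    (hφ : MovesDomain W D G x₀ φ) {x u₀ : E3} (hx : x ∈ W) (hu₀ : u₀ ∈ closure (D x₀)) :
    φ u₀ x ∈ closure (D x) := by
  rw [← hφ.image_eq x hx]
  have hc : ContinuousAt (fun v => φ v x) u₀ :=
    (DifferentiableAt.hasFDerivAt_partial_fst (f := φ)
      ((hφ.contDiffAt x hx u₀ hu₀).differentiableAt (by simp))).continuousAt
  exact hc.continuousWithinAt.mem_closure_image hu₀

/-- Change of variables to the reference domain. -/
theorem MovesDomain.setIntegral_eq {W : Set E3} {D : E3 → Set E3}
    {G : E3 → E3 → Matrix (Fin 3) (Fin 3) ℝ} {x₀ : E3} {φ : E3 → E3 → E3}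
    (hφ : MovesDomain W D G x₀ φ) (hD : IsOpen (D x₀)) {x : E3} (hx : x ∈ W) (f : E3 → F) :
    ∫ u in D x, f u =
      ∫ u₀ in D x₀, |(fderiv ℝ (fun v => φ v x) u₀).det| • f (φ u₀ x) := by
  rw [← hφ.image_eq x hx]
  refine integral_image_eq_integral_abs_det_fderiv_smul volume hD.measurableSet
    (fun u₀ hu₀ => ?_) (hφ.injOn x hx) f
  exact (DifferentiableAt.hasFDerivAt_partial_fst (f := φ)
    ((hφ.contDiffAt x hx u₀ (subset_closure hu₀)).differentiableAt
      (by simp))).differentiableAt.hasFDerivAt.hasFDerivWithinAt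

/-- The volume form of the transport theorem. The integrand on the reference domain is
differentiated under the integral sign; up to the boundary of that domain only the formula for the
derivative is continuous, which is enough for the bound. -/
theorem MovesDomain.hasFDerivAt_setIntegral [CompleteSpace F] {W : Set E3} (hW : IsOpen W)
    {D : E3 → Set E3} {b : E3 → E3 → F} {G : E3 → E3 → Matrix (Fin 3) (Fin 3) ℝ}
    {x₀ : E3} {φ : E3 → E3 → E3} (hφ : MovesDomain W D G x₀ φ)
    (hDo : IsOpen (D x₀)) (hDb : Bornology.IsBounded (D x₀))
    (hb : ∀ x ∈ W, ∀ u ∈ closure (D x),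
      ContDiffAt ℝ 1 (fun p : E3 × E3 => b p.1 p.2) (u, x))
    (hG : ∀ x ∈ W, ∀ u ∈ closure (D x), ∀ i j,
      ContDiffAt ℝ 1 (fun p : E3 × E3 => G p.1 p.2 i j) (u, x)) {x : E3} (hx : x ∈ W) :
    HasFDerivAt (fun y => ∫ u in D y, b u y)
      (∫ u in D x, dotDx fun i => gradX b u x i + divU b G u x i) x := by
  obtain ⟨r, hr, hrW⟩ := Metric.nhds_basis_closedBall.mem_iff.1 (hW.mem_nhds hx)
  set J : E3 × E3 → ℝ := fun p => |(fderiv ℝ (fun v => φ v p.2) p.1).det|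
  set Q : E3 × E3 → E3 →L[ℝ] F := fun p => dotDx fun i => gradX b p.1 p.2 i + divU b G p.1 p.2 i
  have hφc : ∀ y ∈ W, ∀ u₀ ∈ closure (D x₀),
      ContinuousAt (fun p : E3 × E3 => (φ p.1 p.2, p.2)) (u₀, y) := fun y hy u₀ hu₀ =>
    (hφ.contDiffAt y hy u₀ hu₀).continuousAt.prodMk continuousAt_snd
  have hJc : ∀ y ∈ W, ∀ u₀ ∈ closure (D x₀), ContinuousAt J (u₀, y) := fun y hy u₀ hu₀ =>
    (ContinuousLinearMap.continuous_det.continuousAt.comp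
      (ContDiffAt.continuousAt_partial_fst (f := φ) (hφ.contDiffAt y hy u₀ hu₀))).abs
  have hQc : ∀ y ∈ W, ∀ u ∈ closure (D y), ContinuousAt Q (u, y) := by
    intro y hy u hu
    have : Q = fun p => dotDxCLM F fun i => gradX b p.1 p.2 i + divU b G p.1 p.2 i := by
      ext1 p
      rw [dotDxCLM_apply]
    rw [this]
    refine (dotDxCLM F).continuous.continuousAt.comp (continuousAt_pi.2 fun i => ?_)
    exact (continuousAt_gradX (hb y hy u hu) i).add
      (continuousAt_divU (hb y hy u hu) (hG y hy u hu) i)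
  have hJQc : ∀ y ∈ W, ∀ u₀ ∈ closure (D x₀),
      ContinuousAt (fun p : E3 × E3 => J p • Q (φ p.1 p.2, p.2)) (u₀, y) := fun y hy u₀ hu₀ =>
    (hJc y hy u₀ hu₀).smul (ContinuousAt.comp (g := Q)
      (hQc y hy _ (hφ.map_mem_closure hy hu₀)) (hφc y hy u₀ hu₀))
  have hJbc : ∀ y ∈ W, ∀ u₀ ∈ closure (D x₀),
      ContinuousAt (fun u => J (u, y) • b (φ u y) y) u₀ := fun y hy u₀ hu₀ =>
    ContinuousAt.comp (g := fun p : E3 × E3 => J p • b (φ p.1 p.2) p.2) (f := fun u => (u, y))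
      ((hJc y hy u₀ hu₀).smul (ContinuousAt.comp (g := fun p : E3 × E3 => b p.1 p.2)
        (f := fun p : E3 × E3 => (φ p.1 p.2, p.2))
        (hb y hy _ (hφ.map_mem_closure hy hu₀)).continuousAt (hφc y hy u₀ hu₀)))
      (Continuous.prodMk_left y).continuousAt
  -- the derivative of the integrand is bounded by compactness
  obtain ⟨C, hC⟩ :=
    (hDb.isCompact_closure.prod (isCompact_closedBall x r)).exists_bound_of_continuousOn
    (f := fun p : E3 × E3 => J p • Q (φ p.1 p.2, p.2))
    fun p hp => (hJQc p.2 (hrW hp.2) p.1 hp.1).continuousWithinAt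
  have hmain : HasFDerivAt (fun y => ∫ u₀ in D x₀, J (u₀, y) • b (φ u₀ y) y)
      (∫ u₀ in D x₀, J (u₀, x) • Q (φ u₀ x, x)) x := by
    refine hasFDerivAt_integral_of_dominated_of_fderiv_le
      (F := fun y u₀ => J (u₀, y) • b (φ u₀ y) y) (F' := fun y u₀ => J (u₀, y) • Q (φ u₀ y, y))
      (bound := fun _ => C) (Metric.closedBall_mem_nhds x hr) ?_ ?_ ?_ ?_ ?_ ?_
    · filter_upwards [hW.mem_nhds hx] with y hy
      exact (hDb.integrableOn_of_continuousAt_closure (hJbc y hy)).aestronglyMeasurable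
    · exact hDb.integrableOn_of_continuousAt_closure (hJbc x hx)
    · refine (hDb.integrableOn_of_continuousAt_closure fun u₀ hu₀ => ?_).aestronglyMeasurable
      exact ContinuousAt.comp (f := fun u => (u, x)) (hJQc x hx u₀ hu₀)
        (Continuous.prodMk_left x).continuousAt
    · refine (ae_restrict_iff' hDo.measurableSet).2 (.of_forall fun u₀ hu₀ y hy => ?_)
      exact hC (u₀, y) ⟨subset_closure hu₀, hy⟩
    · exact integrableOn_const (hDb.measure_lt_top.ne)
    · refine (ae_restrict_iff' hDo.measurableSet).2 (.of_forall fun u₀ hu₀ y hy => ?_)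
      have hyW := hrW hy
      have hmem := hφ.map_mem_closure hyW (subset_closure hu₀)
      refine hasFDerivAt_abs_jacobian_smul_comp (hb y hyW _ hmem) (hG y hyW _ hmem)
        (hφ.contDiffAt y hyW u₀ (subset_closure hu₀)) ?_ (hφ.jacobian_ne_zero y hyW u₀ hu₀)
      filter_upwards [(hDo.prod hW).mem_nhds (mk_mem_prod hu₀ hyW)] with p hp
      exact hφ.gradient_eq p.2 hp.2 p.1 hp.1
  rw [hφ.setIntegral_eq hDo hx]
  refine hmain.congr_of_eventuallyEq ?_
  filter_upwards [hW.mem_nhds hx] with y hy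
  exact hφ.setIntegral_eq hDo hy _

theorem integral_dotDx {μ : Measure E3} {c : E3 → Fin 3 → F} [CompleteSpace F]
    (hc : ∀ i, Integrable (fun u => c u i) μ) :
    ∫ u, dotDx (c u) ∂μ = dotDx fun i => ∫ u, c u i ∂μ := by
  simp_rw [← dotDxCLM_apply]
  rw [ContinuousLinearMap.integral_comp_comm _ (Integrable.of_eval hc)]
  congr 1
  ext i
  exact eval_integral hc i

end transport

/-! ### Charts that straighten a graph -/

theorem integral_fderiv_apply_eq_zero {V F : Type*} [NormedAddCommGroup V] [NormedSpace ℝ V]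
    [FiniteDimensional ℝ V] [MeasurableSpace V] [BorelSpace V] {μ : Measure V}
    [μ.IsAddHaarMeasure] [NormedAddCommGroup F] [NormedSpace ℝ F] {f : V → F}
    (hf : ContDiff ℝ 1 f) (hc : HasCompactSupport f) (v : V) : ∫ x, fderiv ℝ f x v ∂μ = 0 := by
  have hd : Integrable (fun x => fderiv ℝ f x v) μ :=
    ((hf.continuous_fderiv_apply (by simp)).comp (by fun_prop : Continuous fun x : V => (x, v))
      ).integrable_of_hasCompactSupport (hc.fderiv_apply ℝ v)
  have h := integral_smul_fderiv_eq_neg_fderiv_smul_of_integrable (μ := μ) (𝕜 := ℝ)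
    (f := fun _ : V => (1 : ℝ)) (g := f) (v := v) (by simp) (by simpa using hd)
    (by simpa using hf.continuous.integrable_of_hasCompactSupport hc)
    (fun _ _ => differentiableAt_const _) (fun x _ => hf.differentiable (by simp) x)
  simpa using h

section graphChart

variable {E : Type*} [NormedAddCommGroup E] [InnerProductSpace ℝ E] {n : E}

/-- The chart `(y, t) ↦ p + y + (g y + t) n` around `p`, with `y` orthogonal to the unit vector
`n`.  It maps `{t = 0}` to the graph of `g` and `{t < 0}` to the subgraph. -/
noncomputable def graphChart (p : E) (hn : ‖n‖ = 1) {g : (ℝ ∙ n)ᗮ → ℝ} (hg : Continuous g) :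
    (ℝ ∙ n)ᗮ × ℝ ≃ₜ E where
  toFun z := p + (z.1 + (g z.1 + z.2) • n)
  invFun q := ((ℝ ∙ n)ᗮ.orthogonalProjectionOnto (q - p),
    inner ℝ n (q - p) - g ((ℝ ∙ n)ᗮ.orthogonalProjectionOnto (q - p)))
  left_inv z := by
    have h1 : (ℝ ∙ n)ᗮ.orthogonalProjectionOnto (z.1 + (g z.1 + z.2) • n) = z.1 := by
      have h0 : (ℝ ∙ n)ᗮ.orthogonalProjectionOnto n = 0 :=
        Submodule.orthogonalProjectionOnto_apply_of_mem_orthogonal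
          (Submodule.le_orthogonal_orthogonal _ (Submodule.mem_span_singleton_self n))
      rw [map_add, map_smul, h0, smul_zero, add_zero,
        Submodule.orthogonalProjectionOnto_mem_subspace_eq_self]
    have h2 : inner ℝ n (z.1 : E) = 0 := Submodule.mem_orthogonal_singleton_iff_inner_right.1 z.1.2
    simp only [add_sub_cancel_left, h1, inner_add_right, h2, inner_smul_right,
      real_inner_self_eq_norm_sq, hn]
    ext <;> simp
  right_inv q := by
    have h := Submodule.starProjection_add_starProjection_orthogonal (K := ℝ ∙ n) (q - p)
    rw [Submodule.starProjection_unit_singleton ℝ hn] at h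
    have h' : (((ℝ ∙ n)ᗮ.orthogonalProjectionOnto (q - p) : (ℝ ∙ n)ᗮ) : E) =
      (ℝ ∙ n)ᗮ.starProjection (q - p) := rfl
    simp only [h', add_sub_cancel]
    rw [add_comm ((ℝ ∙ n)ᗮ.starProjection (q - p)), h]
    abel
  continuous_toFun := by fun_prop
  continuous_invFun := by fun_prop

variable (p : E) (hn : ‖n‖ = 1) {g : (ℝ ∙ n)ᗮ → ℝ}

theorem graphChart_apply (hg : Continuous g) (z : (ℝ ∙ n)ᗮ × ℝ) :
    graphChart p hn hg z = p + (z.1 + (g z.1 + z.2) • n) := rfl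

theorem hasFDerivAt_graphChart (hg : ContDiff ℝ 1 g) (z : (ℝ ∙ n)ᗮ × ℝ) :
    HasFDerivAt (graphChart p hn hg.continuous)
      ((ℝ ∙ n)ᗮ.subtypeL ∘L ContinuousLinearMap.fst ℝ _ _ +
        (fderiv ℝ g z.1 ∘L ContinuousLinearMap.fst ℝ _ _ +
          ContinuousLinearMap.snd ℝ _ _).smulRight n) z := by
  have h1 : HasFDerivAt (fun z : (ℝ ∙ n)ᗮ × ℝ => (z.1 : E))
      ((ℝ ∙ n)ᗮ.subtypeL ∘L ContinuousLinearMap.fst ℝ _ _) z :=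
    ((ℝ ∙ n)ᗮ.subtypeL ∘L ContinuousLinearMap.fst ℝ (ℝ ∙ n)ᗮ ℝ).hasFDerivAt
  have h2 := ((hg.differentiable (by simp) z.1).hasFDerivAt.comp z
    (hasFDerivAt_fst (𝕜 := ℝ) (p := z))).add (hasFDerivAt_snd (𝕜 := ℝ) (p := z))
  exact (h1.add (h2.smul_const n)).const_add p

theorem contDiff_graphChart (hg : ContDiff ℝ 1 g) :
    ContDiff ℝ 1 (graphChart p hn hg.continuous) := by
  have h1 : ContDiff ℝ 1 (fun z : (ℝ ∙ n)ᗮ × ℝ => (z.1 : E)) :=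
    ((ℝ ∙ n)ᗮ.subtypeL ∘L ContinuousLinearMap.fst ℝ (ℝ ∙ n)ᗮ ℝ).contDiff
  exact contDiff_const.add (h1.add (((hg.comp contDiff_fst).add contDiff_snd).smul contDiff_const))

variable [FiniteDimensional ℝ E] [MeasurableSpace E] [BorelSpace E]

theorem measurePreserving_graphChart (hg : Continuous g) :
    MeasurePreserving (graphChart p hn hg) := by
  have h1 : MeasurePreserving (fun z : (ℝ ∙ n)ᗮ × ℝ => (z.1, g z.1 + z.2)) := by
    refine (MeasurePreserving.id volume).skew_product (g := fun y t => g y + t)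
      (by unfold Function.uncurry; fun_prop) (.of_forall fun y => ?_)
    exact map_add_left_eq_self volume (g y)
  have h2 : MeasurePreserving ((ℝ ∙ n).measurableEquivProd p).symm volume (volume : Measure E) := by
    rw [← InnerProductSpace.euclideanHausdorffMeasure_eq_volume]
    exact ((ℝ ∙ n).measurePreserving_measurableEquivProd p).symm
  have h3 : MeasurePreserving (fun z : (ℝ ∙ n)ᗮ × ℝ =>
      (LinearIsometryEquiv.toSpanUnitSingleton (𝕜 := ℝ) n hn z.2, z.1)) :=
    ((LinearIsometryEquiv.toSpanUnitSingleton (𝕜 := ℝ) n hn).measurePreserving.prod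
      (MeasurePreserving.id volume)).comp Measure.measurePreserving_swap
  have h4 := h2.comp (h3.comp h1)
  have : (graphChart p hn hg : (ℝ ∙ n)ᗮ × ℝ → E) =
      ((ℝ ∙ n).measurableEquivProd p).symm ∘ ((fun z : (ℝ ∙ n)ᗮ × ℝ =>
      (LinearIsometryEquiv.toSpanUnitSingleton (𝕜 := ℝ) n hn z.2, z.1)) ∘
        fun z : (ℝ ∙ n)ᗮ × ℝ => (z.1, g z.1 + z.2)) := by
    ext z
    simp [graphChart_apply, add_comm]
  rw [this]
  exact h4

variable {F : Type*} [NormedAddCommGroup F] [NormedSpace ℝ F] [CompleteSpace F]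

/-- The divergence theorem for the subgraph of a `C¹` function. The vector
`- ∇g + n` is normal to the graph and its length is the density of surface area. -/
theorem setIntegral_subgraph_fderiv (hg : ContDiff ℝ 1 g) {f : E → F} (hf : ContDiff ℝ 1 f)
    (hc : HasCompactSupport f) (e : E) :
    ∫ q in graphChart p hn hg.continuous '' {z | z.2 < 0}, fderiv ℝ f q e =
      ∫ y, (inner ℝ n e - fderiv ℝ g y ((ℝ ∙ n)ᗮ.orthogonalProjectionOnto e)) •
        f (graphChart p hn hg.continuous (y, 0)) := by
  set Γ := graphChart p hn hg.continuous
  set w := (ℝ ∙ n)ᗮ.orthogonalProjectionOnto e with hw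
  set h : (ℝ ∙ n)ᗮ × ℝ → F := f ∘ Γ with hh
  have hhd : ContDiff ℝ 1 h := hf.comp (contDiff_graphChart p hn hg)
  have hhc : HasCompactSupport h := hc.comp_homeomorph Γ
  have he : e = w + (inner ℝ n e : ℝ) • n := by
    have h := Submodule.starProjection_add_starProjection_orthogonal (K := ℝ ∙ n) e
    rw [Submodule.starProjection_unit_singleton ℝ hn, add_comm] at h
    exact h.symm
  -- in the chart, `e` is the vector `(w, ⟪n, e⟫ - Dg w)`
  have hderiv : ∀ z, fderiv ℝ f (Γ z) e = fderiv ℝ h z (w, 0) +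
      (inner ℝ n e - fderiv ℝ g z.1 w) • fderiv ℝ h z (0, 1) := by
    intro z
    have hcomp := (hf.differentiable (by simp) (Γ z)).hasFDerivAt.comp z
      (hasFDerivAt_graphChart p hn hg z)
    rw [hcomp.fderiv, ← map_smul, ← map_add]
    rw [ContinuousLinearMap.comp_apply]
    congr 1
    conv_lhs => rw [he]
    simp
  have hint : ∀ v, Integrable (fun z => fderiv ℝ h z v) := fun v =>
    ((hhd.continuous_fderiv_apply (by simp)).comp
      (by fun_prop : Continuous fun z : (ℝ ∙ n)ᗮ × ℝ => (z, v))
      ).integrable_of_hasCompactSupport (hhc.fderiv_apply ℝ v)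
  have hint₂ : Integrable (fun z : (ℝ ∙ n)ᗮ × ℝ =>
      (inner ℝ n e - fderiv ℝ g z.1 w) • fderiv ℝ h z (0, 1)) := by
    refine Continuous.integrable_of_hasCompactSupport ?_ (hhc.fderiv_apply ℝ (0, 1)).smul_left
    have := (hg.continuous_fderiv (by simp))
    have := (hhd.continuous_fderiv (by simp))
    fun_prop
  have hset : {z : (ℝ ∙ n)ᗮ × ℝ | z.2 < 0} = univ ×ˢ Iio 0 := by ext; simp
  rw [(measurePreserving_graphChart p hn hg.continuous).setIntegral_image_emb
    Γ.measurableEmbedding]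
  refine (integral_congr_ae (.of_forall hderiv)).trans ?_
  rw [integral_add (hint _).integrableOn hint₂.integrableOn, hset]
  -- the tangential part integrates to zero on each hyperplane `{t = const}`
  have hz : ∫ z in (univ : Set (ℝ ∙ n)ᗮ) ×ˢ Iio (0 : ℝ), fderiv ℝ h z (w, 0) = 0 := by
    rw [Measure.volume_eq_prod, ← Measure.prod_restrict, integral_prod_symm _ (by
      rw [Measure.prod_restrict]; exact (hint _).integrableOn)]
    refine integral_eq_zero_of_ae (.of_forall fun t => ?_)
    have hcl : IsClosedEmbedding fun y : (ℝ ∙ n)ᗮ => (y, t) :=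
      ⟨isEmbedding_prodMkLeft t, by
        convert! (isClosed_univ (X := (ℝ ∙ n)ᗮ)).prod (isClosed_singleton (x := t))
        ext; simp [Prod.ext_iff, eq_comm]⟩
    have h0 := integral_fderiv_apply_eq_zero (μ := (volume : Measure (ℝ ∙ n)ᗮ))
      (hhd.comp (contDiff_id.prodMk contDiff_const : ContDiff ℝ 1 fun y : (ℝ ∙ n)ᗮ => (y, t)))
      (hhc.comp_isClosedEmbedding hcl) w
    rw [Measure.restrict_univ]
    refine Eq.trans (integral_congr_ae (.of_forall fun y => ?_)) h0
    have := HasFDerivAt.comp (f := fun y' : (ℝ ∙ n)ᗮ => (y', t)) y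
      (hhd.differentiable (by simp) (y, t)).hasFDerivAt (hasFDerivAt_prodMk_left (𝕜 := ℝ) y t)
    exact (congrArg (· w) this.fderiv).symm
  rw [hz, zero_add, Measure.volume_eq_prod, setIntegral_prod _ hint₂.integrableOn,
    Measure.restrict_univ]
  refine integral_congr_ae (.of_forall fun y => ?_)
  simp only
  rw [integral_smul]
  congr 1
  have hcl : IsClosedEmbedding fun t : ℝ => (y, t) :=
    ⟨isEmbedding_prodMkRight y, by
      convert! (isClosed_singleton (x := y)).prod (isClosed_univ (X := ℝ))
      ext; simp [Prod.ext_iff, eq_comm]⟩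
  have h0 := HasCompactSupport.integral_Iic_deriv_eq
    (hhd.comp (contDiff_const.prodMk contDiff_id : ContDiff ℝ 1 fun t : ℝ => (y, t)))
    (hhc.comp_isClosedEmbedding hcl) 0
  rw [integral_Iic_eq_integral_Iio] at h0
  refine Eq.trans (integral_congr_ae (.of_forall fun t => ?_)) h0
  have := (hhd.differentiable (by simp) (y, t)).hasFDerivAt.comp_hasDerivAt t
    ((hasDerivAt_const t y).prodMk (hasDerivAt_id t))
  exact this.deriv.symm

/-! ### Surface area of a graph -/

/-- The orthogonal projection onto the hyperplane contracts, so a graph has at least the area of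
the set below it. -/
theorem volume_le_euclideanHausdorffMeasure_graph (hg : Continuous g) (s : Set (ℝ ∙ n)ᗮ) :
    volume s ≤ μHE[Module.finrank ℝ (ℝ ∙ n)ᗮ] ((fun y => graphChart p hn hg (y, 0)) '' s) := by
  rw [← InnerProductSpace.euclideanHausdorffMeasure_eq_volume]
  have hs : s = (fun q => ((graphChart p hn hg).symm q).1) ''
      ((fun y => graphChart p hn hg (y, 0)) '' s) := by
    simp [image_image]
  have hl : LipschitzWith 1 (fun q => ((graphChart p hn hg).symm q).1) := by
    refine LipschitzWith.of_dist_le_mul fun q q' => ?_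
    change dist ((ℝ ∙ n)ᗮ.orthogonalProjectionOnto (q - p))
      ((ℝ ∙ n)ᗮ.orthogonalProjectionOnto (q' - p)) ≤ _
    rw [dist_eq_norm, ← map_sub, sub_sub_sub_cancel_right, NNReal.coe_one, one_mul, dist_eq_norm]
    exact Submodule.norm_orthogonalProjectionOnto_apply_le _ _
  conv_lhs => rw [hs]
  simp only [Measure.euclideanHausdorffMeasure_def, Measure.smul_apply]
  gcongr
  simpa using hl.hausdorffMeasure_image_le (Nat.cast_nonneg _)
    ((fun y => graphChart p hn hg (y, 0)) '' s)

/-- The graph map of a `K`-Lipschitz function is `(1 + K)`-Lipschitz. -/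
theorem euclideanHausdorffMeasure_graph_le (hg : Continuous g) {B s : Set (ℝ ∙ n)ᗮ} {K : NNReal}
    (hK : LipschitzOnWith K g B) (hs : s ⊆ B) :
    μHE[Module.finrank ℝ (ℝ ∙ n)ᗮ] ((fun y => graphChart p hn hg (y, 0)) '' s) ≤
      (1 + K : NNReal) ^ Module.finrank ℝ (ℝ ∙ n)ᗮ * volume s := by
  rw [← InnerProductSpace.euclideanHausdorffMeasure_eq_volume]
  have hl : LipschitzOnWith (1 + K) (fun y => graphChart p hn hg (y, 0)) s := by
    refine LipschitzOnWith.of_dist_le_mul fun y hy y' hy' => ?_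
    have h1 := hK.dist_le_mul y (hs hy) y' (hs hy')
    simp only [graphChart_apply, add_zero, dist_add_left]
    calc dist ((y : E) + g y • n) (y' + g y' • n)
        ≤ dist (y : E) y' + dist (g y • n) (g y' • n) := dist_add_add_le _ _ _ _
      _ = dist y y' + dist (g y) (g y') := by
          rw [dist_eq_norm (g y • n), ← sub_smul, norm_smul, hn, mul_one, ← dist_eq_norm]; rfl
      _ ≤ (1 + K : NNReal) * dist y y' := by push_cast; linarith
  simp only [Measure.euclideanHausdorffMeasure_def, Measure.smul_apply]
  rw [mul_smul_comm]
  gcongr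
  simpa using hl.hausdorffMeasure_image_le (Nat.cast_nonneg (Module.finrank ℝ (ℝ ∙ n)ᗮ))

end graphChart

/-! ### The boundary of a `C¹` domain -/

theorem contDiff_of_forall_mem_tsupport {V F : Type*} [NormedAddCommGroup V]
    [NormedSpace ℝ V] [NormedAddCommGroup F] [NormedSpace ℝ F] {f : V → F}
    (hf : ∀ x ∈ tsupport f, ContDiffAt ℝ 1 f x) : ContDiff ℝ 1 f :=
  contDiff_iff_contDiffAt.2 fun x => by
    by_cases hx : x ∈ tsupport f
    · exact hf x hx
    · exact contDiffAt_const.congr_of_eventuallyEq (notMem_tsupport_iff_eventuallyEq.1 hx)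

/-- A germ of a `C¹` function extends to a global one. -/
theorem ContDiffAt.exists_contDiff_eventuallyEq {V F : Type*} [NormedAddCommGroup V]
    [NormedSpace ℝ V] [FiniteDimensional ℝ V] [NormedAddCommGroup F] [NormedSpace ℝ F]
    {f : V → F} {x : V} (hf : ContDiffAt ℝ 1 f x) :
    ∃ f' : V → F, ContDiff ℝ 1 f' ∧ f' =ᶠ[𝓝 x] f := by
  obtain ⟨r, hr, hball⟩ := Metric.eventually_nhds_iff_ball.1 (hf.eventually (by simp))
  let χ : ContDiffBump x := ⟨r / 3, r / 2, by linarith, by linarith⟩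
  refine ⟨fun y => χ y • f y, contDiff_of_forall_mem_tsupport fun y hy => ?_, ?_⟩
  · refine χ.contDiff.contDiffAt.smul (hball y ?_)
    have hy' := tsupport_smul_subset_left (fun y => χ y) f hy
    rw [χ.tsupport_eq] at hy'
    exact Metric.closedBall_subset_ball (show r / 2 < r by linarith) hy'
  · filter_upwards [χ.eventuallyEq_one] with y hy
    rw [hy]
    simp

theorem IsDefiningFunctionAt.continuousAt_gradient {Ω : Set E3} {ρ : E3 → ℝ} {p : E3}
    (h : IsDefiningFunctionAt Ω ρ p) : ContinuousAt (gradient ρ) p :=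
  (InnerProductSpace.toDual ℝ E3).symm.continuous.continuousAt.comp
    (h.1.continuousAt_fderiv (by simp))

theorem IsDefiningFunctionAt.eventually {Ω : Set E3} {ρ : E3 → ℝ} {p : E3}
    (h : IsDefiningFunctionAt Ω ρ p) : ∀ᶠ q in 𝓝 p, IsDefiningFunctionAt Ω ρ q := by
  filter_upwards [h.1.eventually (by simp), h.continuousAt_gradient.eventually_ne h.2.1,
    h.2.2.eventually_nhds] with q h1 h2 h3
  exact ⟨h1, h2, h3⟩

theorem IsC1Domain.norm_outwardUnitNormal {Ω : Set E3} (hΩ : IsC1Domain Ω) {p : E3}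
    (hp : p ∈ frontier Ω) : ‖outwardUnitNormal Ω p‖ = 1 := by
  obtain ⟨ρ, hρ⟩ := hΩ.boundary p hp
  rw [outwardUnitNormal_eq hΩ.isOpen hp hρ, norm_smul, norm_inv, norm_norm,
    inv_mul_cancel₀ (norm_ne_zero_iff.2 hρ.2.1)]

theorem IsC1Domain.continuousOn_outwardUnitNormal {Ω : Set E3} (hΩ : IsC1Domain Ω) :
    ContinuousOn (outwardUnitNormal Ω) (frontier Ω) := by
  intro p hp
  obtain ⟨ρ, hρ⟩ := hΩ.boundary p hp
  have hc : ContinuousAt (fun q => ‖gradient ρ q‖⁻¹ • gradient ρ q) p :=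
    (hρ.continuousAt_gradient.norm.inv₀ (norm_ne_zero_iff.2 hρ.2.1)).smul
      hρ.continuousAt_gradient
  refine hc.continuousWithinAt.congr_of_eventuallyEq ?_ (outwardUnitNormal_eq hΩ.isOpen hp hρ)
  filter_upwards [hρ.eventually.filter_mono nhdsWithin_le_nhds, self_mem_nhdsWithin] with q hq hq'
  exact outwardUnitNormal_eq hΩ.isOpen hq' hq

theorem norm_graphChart_sub_ge {E : Type*} [NormedAddCommGroup E] [InnerProductSpace ℝ E] {n : E}
    (p : E) (hn : ‖n‖ = 1) {g : (ℝ ∙ n)ᗮ → ℝ} (hg : Continuous g) (z : (ℝ ∙ n)ᗮ × ℝ) :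
    ‖z.1‖ ≤ ‖graphChart p hn hg z - p‖ := by
  have h : z.1 = (ℝ ∙ n)ᗮ.orthogonalProjectionOnto (graphChart p hn hg z - p) :=
    congrArg Prod.fst ((graphChart p hn hg).symm_apply_apply z).symm
  conv_lhs => rw [h]
  exact Submodule.norm_orthogonalProjectionOnto_apply_le _ _

/-- Near a boundary point `p`, a `C¹` domain is the subgraph, in the direction of the normal at
`p`, of a `C¹` function with arbitrarily small derivative. -/
theorem IsC1Domain.exists_graphChart {Ω : Set E3} (hΩ : IsC1Domain Ω) {p : E3}
    (hp : p ∈ frontier Ω) {n : E3} (hn : outwardUnitNormal Ω p = n) (hn1 : ‖n‖ = 1) {ε : ℝ}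
    (hε : 0 < ε) : ∃ (g : (ℝ ∙ n)ᗮ → ℝ) (hg : ContDiff ℝ 1 g), ∃ r > 0,
      (∀ y ∈ Metric.ball 0 r, ‖fderiv ℝ g y‖ ≤ ε) ∧
      ∀ z, graphChart p hn1 hg.continuous z ∈ Metric.ball p r →
        (graphChart p hn1 hg.continuous z ∈ Ω ↔ z.2 < 0) := by
  obtain ⟨ρ, hρ⟩ := hΩ.boundary p hp
  rw [outwardUnitNormal_eq hΩ.isOpen hp hρ] at hn
  have hρp : ρ p = 0 := hρ.eq_zero hΩ.isOpen hp
  set k := ‖gradient ρ p‖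
  have hk : 0 < k := norm_pos_iff.2 hρ.2.1
  have hkn : gradient ρ p = k • n := by rw [← hn, smul_smul, mul_inv_cancel₀ hk.ne', one_smul]
  -- the defining function in the coordinates `(y, s) ↦ p + (y + s n)`
  set L : (ℝ ∙ n)ᗮ × ℝ →L[ℝ] E3 := (ℝ ∙ n)ᗮ.subtypeL ∘L ContinuousLinearMap.fst ℝ _ _ +
    (ContinuousLinearMap.snd ℝ _ _).smulRight n with hL
  have hL_apply : ∀ z, L z = z.1 + z.2 • n := fun z => by simp [hL]
  set R : (ℝ ∙ n)ᗮ × ℝ → ℝ := fun z => ρ (p + L z) with hR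
  have hRc : ContDiffAt ℝ 1 R 0 :=
    ContDiffAt.comp (g := ρ) (f := fun z => p + L z) 0 (by simpa using hρ.1)
      (contDiffAt_const.add L.contDiff.contDiffAt)
  have hR0 : R 0 = 0 := by simp [hR, hρp]
  have hRd : HasFDerivAt R (k • ContinuousLinearMap.snd ℝ _ _) 0 := by
    have h1 : HasFDerivAt ρ (InnerProductSpace.toDual ℝ E3 (gradient ρ p)) (p + L 0) := by
      simpa using (hρ.1.differentiableAt (by simp)).hasGradientAt.hasFDerivAt
    refine (h1.comp 0 (L.hasFDerivAt.const_add p)).congr_fderiv ?_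
    ext z
    · have h2 : inner ℝ n (z : E3) = 0 := Submodule.mem_orthogonal_singleton_iff_inner_right.1 z.2
      simp [hL_apply, hkn, h2]
    · simp [hL_apply, hkn, hn1]
  have hinv : (fderiv ℝ R 0 ∘L .inr ℝ (ℝ ∙ n)ᗮ ℝ).IsInvertible := by
    refine ⟨ContinuousLinearEquiv.unitsEquivAut ℝ (Units.mk0 k hk.ne'), ?_⟩
    ext
    simp [hRd.fderiv]
  have h10 : (1 : WithTop ℕ∞) ≠ 0 := one_ne_zero
  set g₀ := hRc.implicitFunction h10 hinv
  have hg₀0 : g₀ 0 = 0 := hRc.implicitFunction_apply_self h10 hinv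
  have hg₀R : ∀ᶠ y in 𝓝 0, R (y, g₀ y) = 0 := by
    have := hRc.eventually_apply_implicitFunction h10 hinv
    rwa [hR0] at this
  have hg₀d : HasFDerivAt g₀ (0 : (ℝ ∙ n)ᗮ →L[ℝ] ℝ) 0 := by
    refine (hRc.hasStrictFDerivAt_implicitFunction h10 hinv).hasFDerivAt.congr_fderiv ?_
    have : fderiv ℝ R 0 ∘L .inl ℝ (ℝ ∙ n)ᗮ ℝ = 0 := by
      ext
      simp [hRd.fderiv]
    rw [this, ContinuousLinearMap.comp_zero]
    exact neg_zero
  obtain ⟨g, hg, hgg₀⟩ := (hRc.contDiffAt_implicitFunction h10 hinv).exists_contDiff_eventuallyEq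
  have hg0 : g 0 = 0 := hgg₀.self_of_nhds.trans hg₀0
  have hgd : fderiv ℝ g 0 = 0 := (hg₀d.congr_of_eventuallyEq hgg₀).fderiv
  have hgR : ∀ᶠ y in 𝓝 0, R (y, g y) = 0 := by
    filter_upwards [hg₀R, hgg₀] with y h1 h2
    rw [h2]
    exact h1
  set Γ := graphChart p hn1 hg.continuous with hΓ
  have hΓ0 : Γ 0 = p := by simp [hΓ, graphChart_apply, hg0]
  have hΓR : ∀ z, ρ (Γ z) = R (z.1, g z.1 + z.2) := fun z => by
    simp [hΓ, hR, hL_apply, graphChart_apply]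
  have hsmall : ∀ᶠ y in 𝓝 0, ‖fderiv ℝ g y‖ ≤ ε := by
    have hc := (hg.continuous_fderiv (by simp)).norm.tendsto 0
    rw [hgd, norm_zero] at hc
    filter_upwards [hc.eventually (gt_mem_nhds hε)] with y hy using hy.le
  have hstrict := ((hRc.hasStrictFDerivAt h10).isLittleO.bound (half_pos hk))
  have hpair : Tendsto (fun z : (ℝ ∙ n)ᗮ × ℝ => ((z.1, g z.1 + z.2), (z.1, g z.1))) (𝓝 0)
      (𝓝 (0, 0)) := by
    have hgc := hg.continuous
    have : Continuous fun z : (ℝ ∙ n)ᗮ × ℝ => ((z.1, g z.1 + z.2), (z.1, g z.1)) := by fun_prop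
    have h := this.tendsto 0
    rwa [show ((((0 : (ℝ ∙ n)ᗮ × ℝ).1, g (0 : (ℝ ∙ n)ᗮ × ℝ).1 + (0 : (ℝ ∙ n)ᗮ × ℝ).2),
      ((0 : (ℝ ∙ n)ᗮ × ℝ).1, g (0 : (ℝ ∙ n)ᗮ × ℝ).1)) : ((ℝ ∙ n)ᗮ × ℝ) × ((ℝ ∙ n)ᗮ × ℝ)) = (0, 0)
      by simp [hg0]] at h
  have hsign : ∀ᶠ z in 𝓝 0, (Γ z ∈ Ω ↔ z.2 < 0) := by
    have hΓc : Tendsto Γ (𝓝 0) (𝓝 p) := by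
      have := Γ.continuous.tendsto 0
      rwa [hΓ0] at this
    filter_upwards [hpair.eventually hstrict, hΓc.eventually hρ.2.2,
      (continuous_fst.tendsto (0 : (ℝ ∙ n)ᗮ × ℝ)).eventually hgR] with z h1 h2 h3
    rw [h2, hΓR]
    -- `R(y, g y + t)` differs from `k t` by at most `k |t| / 2`, so it has the sign of `t`
    have h4 : |R (z.1, g z.1 + z.2) - k * z.2| ≤ k / 2 * |z.2| := by
      simpa [hRd.fderiv, h3, Prod.norm_def] using h1
    rw [abs_le] at h4
    rcases lt_or_ge z.2 0 with hz | hz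
    · rw [abs_of_neg hz] at h4
      have := mul_neg_of_pos_of_neg hk hz
      exact ⟨fun _ => hz, fun _ => by linarith⟩
    · rw [abs_of_nonneg hz] at h4
      have := mul_nonneg hk.le hz
      exact ⟨fun h => by linarith, fun h => absurd h (not_lt.2 hz)⟩
  have hsign' : ∀ᶠ q in 𝓝 p, (q ∈ Ω ↔ (Γ.symm q).2 < 0) := by
    have hΓc : Tendsto Γ.symm (𝓝 p) (𝓝 0) := by
      have := Γ.symm.continuous.tendsto p
      rwa [← hΓ0, Γ.symm_apply_apply, hΓ0] at this
    filter_upwards [hΓc.eventually hsign] with q hq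
    simpa using hq
  obtain ⟨r₁, hr₁, h₁⟩ := Metric.eventually_nhds_iff_ball.1 hsmall
  obtain ⟨r₂, hr₂, h₂⟩ := Metric.eventually_nhds_iff_ball.1 hsign'
  refine ⟨g, hg, min r₁ r₂, lt_min hr₁ hr₂,
    fun y hy => h₁ y (Metric.ball_subset_ball (min_le_left _ _) hy), fun z hz => ?_⟩
  have h := h₂ _ (Metric.ball_subset_ball (min_le_right _ _) hz)
  rwa [Γ.symm_apply_apply] at h

/-! ### The divergence theorem on a boundary patch -/

section comparison

variable {α F : Type*} [MeasurableSpace α] [NormedAddCommGroup F] [NormedSpace ℝ F]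

/-- Integrals against two measures that agree up to a factor `1 + δ`. -/
theorem norm_integral_sub_integral_le_of_le_smul {μ ν : Measure α} [IsFiniteMeasure ν]
    {δ : NNReal} (h₁ : ν ≤ μ) (h₂ : μ ≤ (1 + δ) • ν) {f : α → F} (hf : Integrable f μ) :
    ‖∫ x, f x ∂μ - ∫ x, f x ∂ν‖ ≤ δ * ∫ x, ‖f x‖ ∂ν := by
  have hsub : μ - ν ≤ δ • ν := Measure.sub_le_of_le_add (by
    rwa [add_smul, one_smul, add_comm] at h₂)
  have hμ : μ = (μ - ν) + ν := (Measure.sub_add_cancel_of_le h₁).symm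
  have hfν : Integrable f ν := hf.mono_measure h₁
  have hfs : Integrable f (μ - ν) := hf.mono_measure Measure.sub_le
  have hsplit : ∫ x, f x ∂μ = ∫ x, f x ∂(μ - ν) + ∫ x, f x ∂ν := by
    conv_lhs => rw [hμ]
    exact integral_add_measure hfs hfν
  rw [hsplit, add_sub_cancel_right]
  calc ‖∫ x, f x ∂(μ - ν)‖ ≤ ∫ x, ‖f x‖ ∂(μ - ν) := norm_integral_le_integral_norm _
    _ ≤ ∫ x, ‖f x‖ ∂(δ • ν) :=
      integral_mono_measure hsub (.of_forall fun _ => norm_nonneg _)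
        (hfν.norm.smul_measure_nnreal)
    _ = δ * ∫ x, ‖f x‖ ∂ν := by rw [integral_smul_nnreal_measure]; rfl

theorem setIntegral_congr_of_inter_eq {μ : Measure α} {s t U : Set α} (hs : MeasurableSet s)
    (ht : MeasurableSet t) (h : s ∩ U = t ∩ U) {f : α → F} (hf : ∀ x ∉ U, f x = 0) :
    ∫ x in s, f x ∂μ = ∫ x in t, f x ∂μ := by
  rw [setIntegral_eq_of_subset_of_forall_sdiff_eq_zero hs (inter_subset_left (t := U))
    fun x hx => hf x fun hU => hx.2 ⟨hx.1, hU⟩, h,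
    ← setIntegral_eq_of_subset_of_forall_sdiff_eq_zero ht (inter_subset_left (t := U))
    fun x hx => hf x fun hU => hx.2 ⟨hx.1, hU⟩]

/-- Replacing a scalar factor by a nearby constant changes the integral by little. -/
theorem norm_integral_smul_sub_smul_integral_le {μ : Measure α} {m : α → ℝ} {f : α → F}
    (hf : Integrable f μ) (hm : AEStronglyMeasurable m μ) {c κ : ℝ}
    (h : ∀ᵐ x ∂μ, f x ≠ 0 → |m x - c| ≤ κ) :
    ‖(∫ x, m x • f x ∂μ) - c • ∫ x, f x ∂μ‖ ≤ κ * ∫ x, ‖f x‖ ∂μ := by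
  have hbd : ∀ᵐ x ∂μ, ‖(m x - c) • f x‖ ≤ κ * ‖f x‖ := by
    filter_upwards [h] with x hx
    by_cases h0 : f x = 0
    · simp [h0]
    · rw [norm_smul, Real.norm_eq_abs]
      exact mul_le_mul_of_nonneg_right (hx h0) (norm_nonneg _)
  have hint : Integrable (fun x => (m x - c) • f x) μ :=
    (hf.norm.const_mul κ).mono' ((hm.sub aestronglyMeasurable_const).smul hf.aestronglyMeasurable)
      hbd
  have hsplit : ∫ x, m x • f x ∂μ = (∫ x, (m x - c) • f x ∂μ) + c • ∫ x, f x ∂μ := by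
    have hfc : Integrable (fun x => c • f x) μ := hf.smul c
    rw [← integral_smul, ← integral_add hint hfc]
    refine integral_congr_ae (.of_forall fun x => ?_)
    simp only
    rw [← add_smul, sub_add_cancel]
  rw [hsplit, add_sub_cancel_right, ← integral_const_mul]
  exact norm_integral_le_of_norm_le (hf.norm.const_mul _) hbd

end comparison

section graphMeasure

variable {E : Type*} [NormedAddCommGroup E] [InnerProductSpace ℝ E] {n : E}

theorem isClosedEmbedding_graph (p : E) (hn : ‖n‖ = 1) {g : (ℝ ∙ n)ᗮ → ℝ} (hg : Continuous g) :
    IsClosedEmbedding fun y : (ℝ ∙ n)ᗮ => graphChart p hn hg (y, 0) :=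
  (graphChart p hn hg).isClosedEmbedding.comp ⟨isEmbedding_prodMkLeft 0, by
    convert! (isClosed_univ (X := (ℝ ∙ n)ᗮ)).prod (isClosed_singleton (x := (0 : ℝ)))
    ext; simp [Prod.ext_iff, eq_comm]⟩

theorem frontier_image_graphChart (p : E) (hn : ‖n‖ = 1) {g : (ℝ ∙ n)ᗮ → ℝ}
    (hg : Continuous g) : frontier (graphChart p hn hg '' {z | z.2 < 0}) =
      range fun y : (ℝ ∙ n)ᗮ => graphChart p hn hg (y, 0) := by
  have h : {z : (ℝ ∙ n)ᗮ × ℝ | z.2 < 0} = univ ×ˢ Iio 0 := by ext; simp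
  have h' : frontier {z : (ℝ ∙ n)ᗮ × ℝ | z.2 < 0} = range fun y => (y, 0) := by
    rw [h, frontier_univ_prod_eq, frontier_Iio]
    ext
    simp [Prod.ext_iff, eq_comm]
  rw [← (graphChart p hn hg).image_frontier, h', ← range_comp]
  rfl

variable [FiniteDimensional ℝ E] [MeasurableSpace E] [BorelSpace E]

/-- Two-sided comparison of surface area on the graph of a Lipschitz function with the push-forward
of Lebesgue measure. -/
theorem map_graph_le_and_le (p : E) (hn : ‖n‖ = 1) {g : (ℝ ∙ n)ᗮ → ℝ} (hg : Continuous g)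
    {B : Set (ℝ ∙ n)ᗮ} {K : NNReal} (hK : LipschitzOnWith K g B) {d : ℕ}
    (hd : Module.finrank ℝ (ℝ ∙ n)ᗮ = d) :
    (volume.restrict B).map (fun y => graphChart p hn hg (y, 0)) ≤
      (μHE[d] : Measure E).restrict ((fun y => graphChart p hn hg (y, 0)) '' B) ∧
    (μHE[d] : Measure E).restrict ((fun y => graphChart p hn hg (y, 0)) '' B) ≤
      (1 + K) ^ d • (volume.restrict B).map (fun y => graphChart p hn hg (y, 0)) := by
  subst hd
  have hγ := (isClosedEmbedding_graph p hn hg).measurableEmbedding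
  set γ : (ℝ ∙ n)ᗮ → E := fun y => graphChart p hn hg (y, 0)
  have himg : ∀ A, A ∩ γ '' B = γ '' (γ ⁻¹' A ∩ B) := fun A => by
    rw [inter_comm (γ ⁻¹' A), image_inter_preimage, inter_comm]
  refine ⟨Measure.le_iff.2 fun A hA => ?_, Measure.le_iff.2 fun A hA => ?_⟩
  · rw [hγ.map_apply, Measure.restrict_apply hA, Measure.restrict_apply (hγ.measurable hA), himg]
    exact volume_le_euclideanHausdorffMeasure_graph p hn hg _
  · rw [Measure.smul_apply, hγ.map_apply, Measure.restrict_apply hA,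
      Measure.restrict_apply (hγ.measurable hA), himg]
    refine (euclideanHausdorffMeasure_graph_le p hn hg hK inter_subset_right).trans_eq ?_
    rw [ENNReal.smul_def, smul_eq_mul, ENNReal.coe_pow]

theorem isFiniteMeasure_restrict_graph (p : E) (hn : ‖n‖ = 1) {g : (ℝ ∙ n)ᗮ → ℝ}
    (hg : Continuous g) {r : ℝ} {K : NNReal} (hK : LipschitzOnWith K g (Metric.ball 0 r)) {d : ℕ}
    (hd : Module.finrank ℝ (ℝ ∙ n)ᗮ = d) :
    IsFiniteMeasure ((μHE[d] : Measure E).restrict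
      ((fun y => graphChart p hn hg (y, 0)) '' Metric.ball 0 r)) := by
  have : IsFiniteMeasure (volume.restrict (Metric.ball (0 : (ℝ ∙ n)ᗮ) r)) := ⟨by
    rw [Measure.restrict_apply_univ]; exact measure_ball_lt_top⟩
  exact isFiniteMeasure_of_le _ (map_graph_le_and_le p hn hg hK hd).2

variable {F : Type*} [NormedAddCommGroup F] [NormedSpace ℝ F] [CompleteSpace F]

/-- If `Dg` is small, then the integral of a directional derivative over the subgraph of `g` is
close to the flux in the constant direction `n`, with area measured in the hyperplane below. -/
theorem norm_setIntegral_subgraph_sub_le_map (p : E) (hn : ‖n‖ = 1) {g : (ℝ ∙ n)ᗮ → ℝ}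
    (hg : ContDiff ℝ 1 g) {B : Set (ℝ ∙ n)ᗮ} (hB : MeasurableSet B) {η : ℝ}
    (hgB : ∀ y ∈ B, ‖fderiv ℝ g y‖ ≤ η) {f : E → F} (hf : ContDiff ℝ 1 f)
    (hc : HasCompactSupport f) (hfB : ∀ y ∉ B, f (graphChart p hn hg.continuous (y, 0)) = 0)
    (e : E) :
    ‖(∫ q in graphChart p hn hg.continuous '' {z | z.2 < 0}, fderiv ℝ f q e) -
      (inner ℝ n e : ℝ) • ∫ q, f q
        ∂(volume.restrict B).map (fun y => graphChart p hn hg.continuous (y, 0))‖ ≤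
    η * ‖e‖ * ∫ q, ‖f q‖
        ∂(volume.restrict B).map (fun y => graphChart p hn hg.continuous (y, 0)) := by
  have hγ := isClosedEmbedding_graph p hn hg.continuous
  rw [setIntegral_subgraph_fderiv p hn hg hf hc e, hγ.measurableEmbedding.integral_map,
    hγ.measurableEmbedding.integral_map,
    ← setIntegral_eq_integral_of_forall_compl_eq_zero (s := B)
      fun y hy => by rw [hfB y hy, smul_zero]]
  refine norm_integral_smul_sub_smul_integral_le ?_ ?_
    ((ae_restrict_iff' hB).2 (.of_forall fun y hy _ => ?_))
  · exact ((hf.continuous.comp hγ.continuous).integrable_of_hasCompactSupport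
      (hc.comp_isClosedEmbedding hγ)).restrict
  · have := hg.continuous_fderiv (by simp)
    exact Continuous.aestronglyMeasurable (by fun_prop)
  · rw [sub_sub_cancel_left, abs_neg]
    exact (ContinuousLinearMap.le_opNorm _ _).trans (mul_le_mul (hgB y hy)
      (Submodule.norm_orthogonalProjectionOnto_apply_le _ _) (norm_nonneg _)
      ((norm_nonneg (fderiv ℝ g y)).trans (hgB y hy)))

/-- The estimate `norm_setIntegral_subgraph_sub_le_map` with surface area in place of the
push-forward of Lebesgue measure. The constant is for surfaces: `(1 + K) ^ 2 ≤ 1 + 3 K`. -/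
theorem norm_setIntegral_subgraph_sub_le (p : E) (hn : ‖n‖ = 1)
    (hd : Module.finrank ℝ (ℝ ∙ n)ᗮ = 2) {g : (ℝ ∙ n)ᗮ → ℝ}
    (hg : ContDiff ℝ 1 g) {r : ℝ} {K : NNReal} (hK1 : K ≤ 1)
    (hgB : ∀ y ∈ Metric.ball 0 r, ‖fderiv ℝ g y‖ ≤ K) {f : E → F} (hf : ContDiff ℝ 1 f)
    (hc : HasCompactSupport f)
    (hfB : ∀ y ∉ Metric.ball 0 r, f (graphChart p hn hg.continuous (y, 0)) = 0) (e : E) :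
    ‖(∫ q in graphChart p hn hg.continuous '' {z | z.2 < 0}, fderiv ℝ f q e) -
      (inner ℝ n e : ℝ) •
        ∫ q in (fun y => graphChart p hn hg.continuous (y, 0)) '' Metric.ball 0 r, f q ∂μHE[2]‖ ≤
    4 * K * ‖e‖ *
      ∫ q in (fun y => graphChart p hn hg.continuous (y, 0)) '' Metric.ball 0 r, ‖f q‖ ∂μHE[2] := by
  have hB : MeasurableSet (Metric.ball (0 : (ℝ ∙ n)ᗮ) r) := Metric.isOpen_ball.measurableSet
  have hK : LipschitzOnWith K g (Metric.ball 0 r) :=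
    (convex_ball 0 r).lipschitzOnWith_of_nnnorm_fderiv_le
      (fun y _ => hg.differentiable (by simp) y) fun y hy => hgB y hy
  have hσ := isFiniteMeasure_restrict_graph p hn hg.continuous hK hd
  obtain ⟨hle₁, hle₂⟩ := map_graph_le_and_le p hn hg.continuous hK hd
  have he₁ := norm_setIntegral_subgraph_sub_le_map p hn hg hB hgB hf hc hfB e
  set ν := (volume.restrict (Metric.ball 0 r)).map
    (fun y => graphChart p hn hg.continuous (y, 0))
  set σ := (μHE[2] : Measure E).restrict
    ((fun y => graphChart p hn hg.continuous (y, 0)) '' Metric.ball 0 r)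
  have : IsFiniteMeasure ν := isFiniteMeasure_of_le _ hle₁
  rw [show (1 + K) ^ 2 = 1 + (2 * K + K ^ 2) by ring] at hle₂
  have hfσ : Integrable f σ := by
    obtain ⟨C, hC⟩ := hf.continuous.bounded_above_of_compact_support hc
    exact Integrable.of_bound hf.continuous.aestronglyMeasurable C (.of_forall hC)
  have hνσ : ∫ u, ‖f u‖ ∂ν ≤ ∫ u, ‖f u‖ ∂σ :=
    integral_mono_measure hle₁ (.of_forall fun _ => norm_nonneg _) hfσ.norm
  have hν0 : 0 ≤ ∫ u, ‖f u‖ ∂ν := integral_nonneg fun _ => norm_nonneg _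
  have he₂ := norm_integral_sub_integral_le_of_le_smul hle₁ hle₂ hfσ
  have hδ : ((2 * K + K ^ 2 : NNReal) : ℝ) ≤ 3 * K := by
    have h1 : (K : ℝ) ≤ 1 := hK1
    push_cast
    nlinarith [K.coe_nonneg]
  set I := ∫ q in graphChart p hn hg.continuous '' {z | z.2 < 0}, fderiv ℝ f q e
  have hc' : |inner ℝ n e| ≤ ‖e‖ := by simpa [hn] using abs_real_inner_le_norm n e
  calc ‖I - (inner ℝ n e : ℝ) • ∫ q, f q ∂σ‖
      = ‖(I - (inner ℝ n e : ℝ) • ∫ q, f q ∂ν) -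
          (inner ℝ n e : ℝ) • ((∫ q, f q ∂σ) - ∫ q, f q ∂ν)‖ := by
        rw [smul_sub]; congr 1; abel
    _ ≤ K * ‖e‖ * (∫ q, ‖f q‖ ∂ν) + ‖e‖ * (3 * K * ∫ q, ‖f q‖ ∂ν) := by
        refine (norm_sub_le _ _).trans (add_le_add he₁ ?_)
        rw [norm_smul, Real.norm_eq_abs]
        gcongr
        exact he₂.trans (mul_le_mul_of_nonneg_right hδ hν0)
    _ = 4 * K * ‖e‖ * ∫ q, ‖f q‖ ∂ν := by ring
    _ ≤ 4 * K * ‖e‖ * ∫ q, ‖f q‖ ∂σ := by gcongr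

end graphMeasure

theorem frontier_inter_eq_of_inter_eq {X : Type*} [TopologicalSpace X] {s t U : Set X}
    (hU : IsOpen U) (h : s ∩ U = t ∩ U) : frontier s ∩ U = frontier t ∩ U := by
  rw [← frontier_inter_open_inter hU, h, frontier_inter_open_inter hU]

/-- The local picture at a boundary point `p` of a `C¹` domain: in a ball around `p`, the domain and
its boundary are the subgraph and the graph of a function with small derivative, and the normal is
almost constant. -/
theorem IsC1Domain.exists_local_graph {Ω : Set E3} (hΩ : IsC1Domain Ω) {p : E3}
    (hp : p ∈ frontier Ω) {ε : ℝ} (hε : 0 < ε) :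
    ∃ (n : E3) (hn : ‖n‖ = 1) (g : (ℝ ∙ n)ᗮ → ℝ) (hg : ContDiff ℝ 1 g), ∃ r > 0,
      (∀ y ∈ Metric.ball 0 r, ‖fderiv ℝ g y‖ ≤ ε) ∧
      (∀ y ∉ Metric.ball 0 r, graphChart p hn hg.continuous (y, 0) ∉ Metric.ball p r) ∧
      (∀ q ∈ frontier Ω ∩ Metric.ball p r, ‖outwardUnitNormal Ω q - n‖ ≤ ε) ∧
      Ω ∩ Metric.ball p r =
        graphChart p hn hg.continuous '' {z | z.2 < 0} ∩ Metric.ball p r ∧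
      frontier Ω ∩ Metric.ball p r =
        (fun y => graphChart p hn hg.continuous (y, 0)) '' Metric.ball 0 r ∩ Metric.ball p r := by
  obtain ⟨n, hn⟩ : ∃ n, outwardUnitNormal Ω p = n := ⟨_, rfl⟩
  have hn1 : ‖n‖ = 1 := hn ▸ hΩ.norm_outwardUnitNormal hp
  obtain ⟨g, hg, r₁, hr₁, hgε, hΓΩ⟩ := hΩ.exists_graphChart hp hn hn1 hε
  obtain ⟨r₂, hr₂, hnε⟩ := Metric.continuousWithinAt_iff.1
    (hΩ.continuousOn_outwardUnitNormal p hp) ε hε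
  rw [hn] at hnε
  have hball : ∀ y, graphChart p hn1 hg.continuous (y, 0) ∈ Metric.ball p (min r₁ r₂) →
      y ∈ Metric.ball 0 (min r₁ r₂) := fun y hy => by
    rw [mem_ball_zero_iff]
    exact (norm_graphChart_sub_ge p hn1 hg.continuous (y, 0)).trans_lt (mem_ball_iff_norm.1 hy)
  have hΩU : Ω ∩ Metric.ball p (min r₁ r₂) =
      graphChart p hn1 hg.continuous '' {z | z.2 < 0} ∩ Metric.ball p (min r₁ r₂) := by
    ext q
    obtain ⟨z, rfl⟩ := (graphChart p hn1 hg.continuous).surjective q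
    simp only [mem_inter_iff, (graphChart p hn1 hg.continuous).injective.mem_set_image,
      mem_ofPred_eq, and_congr_left_iff]
    exact fun hz => hΓΩ z (Metric.ball_subset_ball (min_le_left _ _) hz)
  refine ⟨n, hn1, g, hg, min r₁ r₂, lt_min hr₁ hr₂,
    fun y hy => hgε y (Metric.ball_subset_ball (min_le_left _ _) hy),
    fun y hy h => hy (hball y h), fun q hq => ?_, hΩU, ?_⟩
  · have := hnε hq.1 (Metric.ball_subset_ball (min_le_right _ _) hq.2)
    rw [dist_eq_norm] at this
    exact this.le
  · rw [frontier_inter_eq_of_inter_eq Metric.isOpen_ball hΩU, frontier_image_graphChart]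
    ext q
    constructor
    · rintro ⟨⟨y, rfl⟩, hq⟩
      exact ⟨⟨y, hball y hq, rfl⟩, hq⟩
    · rintro ⟨hq', hq⟩
      exact ⟨image_subset_range _ _ hq', hq⟩

section patch

variable {F : Type*} [NormedAddCommGroup F] [NormedSpace ℝ F]

theorem IsC1Domain.norm_setIntegral_inner_normal_sub_le {Ω : Set E3} (hΩ : IsC1Domain Ω)
    {n : E3} {ε : ℝ} {U : Set E3} (hnε : ∀ q ∈ frontier Ω ∩ U, ‖outwardUnitNormal Ω q - n‖ ≤ ε)
    {f : E3 → F} (hf : IntegrableOn f (frontier Ω) (μHE[2] : Measure E3)) (hf0 : ∀ u ∉ U, f u = 0)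
    (e : E3) :
    ‖(∫ u in frontier Ω, inner ℝ (outwardUnitNormal Ω u) e • f u ∂(μHE[2] : Measure E3)) -
      (inner ℝ n e : ℝ) • ∫ u in frontier Ω, f u ∂(μHE[2] : Measure E3)‖ ≤
    ε * ‖e‖ * ∫ u in frontier Ω, ‖f u‖ ∂(μHE[2] : Measure E3) := by
  have hfrm : MeasurableSet (frontier Ω) := isClosed_frontier.measurableSet
  refine norm_integral_smul_sub_smul_integral_le hf
    ((hΩ.continuousOn_outwardUnitNormal.inner continuousOn_const).aestronglyMeasurable hfrm)
    ((ae_restrict_iff' hfrm).2 (.of_forall fun u hu hfu => ?_))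
  have huU : u ∈ U := by_contra fun h => hfu (hf0 u h)
  rw [← inner_sub_left]
  exact (abs_real_inner_le_norm _ _).trans
    (mul_le_mul_of_nonneg_right (hnε u ⟨hu, huU⟩) (norm_nonneg _))

/-- The divergence theorem holds, up to an arbitrarily small relative error, for functions with
support near a given boundary point.  Over a small patch the normal is almost constant and the
boundary is almost a flat disc, so no formula for the density of surface area is needed. -/
theorem IsC1Domain.exists_frontier_patch [CompleteSpace F] {Ω : Set E3} (hΩ : IsC1Domain Ω)
    {p : E3} (hp : p ∈ frontier Ω) {ε : ℝ} (hε : 0 < ε) :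
    ∃ r > 0, (μHE[2] : Measure E3) (frontier Ω ∩ Metric.ball p r) < ⊤ ∧
      ∀ f : E3 → F, ContDiff ℝ 1 f → HasCompactSupport f → tsupport f ⊆ Metric.ball p r → ∀ e,
        ‖(∫ u in Ω, fderiv ℝ f u e) -
          ∫ u in frontier Ω, inner ℝ (outwardUnitNormal Ω u) e • f u ∂(μHE[2] : Measure E3)‖ ≤
        ε * ‖e‖ * ∫ u in frontier Ω, ‖f u‖ ∂(μHE[2] : Measure E3) := by
  obtain ⟨η, hη0, hη1, hηε⟩ : ∃ η : NNReal, 0 < (η : ℝ) ∧ η ≤ 1 ∧ 5 * (η : ℝ) ≤ ε := by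
    refine ⟨min 1 (Real.toNNReal (ε / 5)), ?_, min_le_left _ _, ?_⟩
    · simpa using hε
    · have : min 1 (ε / 5) ≤ ε / 5 := min_le_right _ _
      rw [NNReal.coe_min, Real.coe_toNNReal _ (by positivity), NNReal.coe_one]
      linarith
  obtain ⟨n, hn, g, hg, r, hr, hgη, hball, hnη, hΩU, hfrU⟩ := hΩ.exists_local_graph hp hη0
  have hd : Module.finrank ℝ (ℝ ∙ n)ᗮ = 2 := by
    have : Fact (Module.finrank ℝ E3 = 2 + 1) := ⟨by simp⟩
    exact Submodule.finrank_orthogonal_span_singleton (norm_ne_zero_iff.1 (by rw [hn]; simp))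
  have hK : LipschitzOnWith η g (Metric.ball 0 r) :=
    (convex_ball 0 r).lipschitzOnWith_of_nnnorm_fderiv_le
      (fun y _ => hg.differentiable (by simp) y) fun y hy => hgη y hy
  have hσ := isFiniteMeasure_restrict_graph p hn hg.continuous hK hd
  have hmain := fun {f : E3 → F} hf hc hfB e =>
    norm_setIntegral_subgraph_sub_le p hn hd hg hη1 hgη (f := f) hf hc hfB e
  have hSm : MeasurableSet
      ((fun y => graphChart p hn hg.continuous (y, 0)) '' Metric.ball 0 r) :=
    (isClosedEmbedding_graph p hn hg.continuous).measurableEmbedding.measurableSet_image.2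
      Metric.isOpen_ball.measurableSet
  have hsub : MeasurableSet (graphChart p hn hg.continuous '' {z | z.2 < 0}) :=
    (graphChart p hn hg.continuous).measurableEmbedding.measurableSet_image.2
      (measurableSet_lt measurable_snd measurable_const)
  generalize (fun y => graphChart p hn hg.continuous (y, 0)) '' Metric.ball 0 r = S at *
  generalize graphChart p hn hg.continuous '' {z | z.2 < 0} = Ω' at *
  have hfrm : MeasurableSet (frontier Ω) := isClosed_frontier.measurableSet
  refine ⟨r, hr, ?_, fun f hf hfc hfU e => ?_⟩
  · rw [hfrU]
    calc (μHE[2] : Measure E3) (S ∩ Metric.ball p r) ≤ (μHE[2] : Measure E3) S :=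
          measure_mono inter_subset_left
      _ = (μHE[2] : Measure E3).restrict S univ := by rw [Measure.restrict_apply_univ]
      _ < ⊤ := measure_lt_top _ _
  have hf0 : ∀ u ∉ Metric.ball p r, f u = 0 := fun u hu =>
    image_eq_zero_of_notMem_tsupport fun h => hu (hfU h)
  have hfd0 : ∀ u ∉ Metric.ball p r, fderiv ℝ f u e = 0 := fun u hu => by
    rw [fderiv_of_notMem_tsupport ℝ fun h => hu (hfU h)]
    rfl
  have e₁ := hmain hf hfc (fun y hy => hf0 _ (hball y hy)) e
  have hfi : IntegrableOn f (frontier Ω) (μHE[2] : Measure E3) := by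
    have hfS : IntegrableOn f S (μHE[2] : Measure E3) := by
      obtain ⟨C, hC⟩ := hf.continuous.bounded_above_of_compact_support hfc
      exact Integrable.of_bound (hf.continuous.aestronglyMeasurable) C (.of_forall hC)
    have h1 : IntegrableOn f (frontier Ω ∩ Metric.ball p r) (μHE[2] : Measure E3) := by
      rw [hfrU]
      exact hfS.mono_set inter_subset_left
    exact h1.of_forall_sdiff_eq_zero hfrm fun u hu => hf0 u fun h => hu.2 ⟨hu.1, h⟩
  have e₂ := hΩ.norm_setIntegral_inner_normal_sub_le hnη hfi hf0 e
  rw [← setIntegral_congr_of_inter_eq hΩ.isOpen.measurableSet hsub hΩU hfd0,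
    ← setIntegral_congr_of_inter_eq hfrm hSm hfrU (f := fun u => ‖f u‖)
      (fun u hu => by rw [hf0 u hu, norm_zero]),
    ← setIntegral_congr_of_inter_eq hfrm hSm hfrU hf0] at e₁
  have h0 : 0 ≤ ∫ u in frontier Ω, ‖f u‖ ∂(μHE[2] : Measure E3) :=
    integral_nonneg fun _ => norm_nonneg _
  set I := ∫ u in frontier Ω, ‖f u‖ ∂(μHE[2] : Measure E3)
  calc _ ≤ _ := norm_sub_le_norm_sub_add_norm_sub _
          ((inner ℝ n e : ℝ) • ∫ u in frontier Ω, f u ∂(μHE[2] : Measure E3)) _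
    _ ≤ 4 * η * ‖e‖ * I + η * ‖e‖ * I := add_le_add e₁ (by rw [norm_sub_rev]; exact e₂)
    _ = 5 * η * (‖e‖ * I) := by ring
    _ ≤ ε * (‖e‖ * I) := by gcongr
    _ = ε * ‖e‖ * I := by ring

end patch

/-! ### The divergence theorem on a bounded `C¹` domain -/

theorem IsC1Domain.euclideanHausdorffMeasure_frontier_lt_top {Ω : Set E3} (hΩ : IsC1Domain Ω) :
    (μHE[2] : Measure E3) (frontier Ω) < ⊤ := by
  have hc : IsCompact (frontier Ω) :=
    hΩ.isBounded.isCompact_closure.of_isClosed_subset isClosed_frontier frontier_subset_closure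
  refine hc.measure_lt_top_of_nhdsWithin fun p hp => ?_
  obtain ⟨r, hr, hfin, -⟩ := hΩ.exists_frontier_patch (F := ℝ) hp one_pos
  exact ⟨_, inter_mem_nhdsWithin _ (Metric.ball_mem_nhds p hr), hfin⟩

theorem IsC1Domain.integrableOn_frontier {F : Type*} [NormedAddCommGroup F] {Ω : Set E3}
    (hΩ : IsC1Domain Ω) {f : E3 → F} (hf : ContinuousOn f (frontier Ω)) :
    IntegrableOn f (frontier Ω) (μHE[2] : Measure E3) := by
  have hc : IsCompact (frontier Ω) :=
    hΩ.isBounded.isCompact_closure.of_isClosed_subset isClosed_frontier frontier_subset_closure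
  obtain ⟨C, hC⟩ := hc.exists_bound_of_continuousOn hf
  have hm : MeasurableSet (frontier Ω) := isClosed_frontier.measurableSet
  have : IsFiniteMeasure ((μHE[2] : Measure E3).restrict (frontier Ω)) := ⟨by
    rw [Measure.restrict_apply_univ]
    exact hΩ.euclideanHausdorffMeasure_frontier_lt_top⟩
  exact Integrable.of_bound (hf.aestronglyMeasurable hm) C ((ae_restrict_iff' hm).2 (.of_forall hC))

section divergence

variable {F : Type*} [NormedAddCommGroup F] [NormedSpace ℝ F]

/-- The approximate divergence theorem near any point of the closure; near interior points both
sides vanish. -/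
theorem IsC1Domain.exists_patch [CompleteSpace F] {Ω : Set E3} (hΩ : IsC1Domain Ω)
    {p : E3} (hp : p ∈ closure Ω) {ε : ℝ} (hε : 0 < ε) :
    ∃ r > 0, ∀ f : E3 → F, ContDiff ℝ 1 f → HasCompactSupport f → tsupport f ⊆ Metric.ball p r →
      ∀ e, ‖(∫ u in Ω, fderiv ℝ f u e) -
          ∫ u in frontier Ω, inner ℝ (outwardUnitNormal Ω u) e • f u ∂(μHE[2] : Measure E3)‖ ≤
        ε * ‖e‖ * ∫ u in frontier Ω, ‖f u‖ ∂(μHE[2] : Measure E3) := by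
  by_cases hpΩ : p ∈ Ω
  · obtain ⟨r, hr, hball⟩ := Metric.isOpen_iff.1 hΩ.isOpen p hpΩ
    refine ⟨r, hr, fun f hf hfc hfU e => ?_⟩
    have h1 : ∫ u in Ω, fderiv ℝ f u e = 0 := by
      rw [setIntegral_eq_integral_of_forall_compl_eq_zero fun u hu => ?_]
      · exact integral_fderiv_apply_eq_zero hf hfc e
      · rw [fderiv_of_notMem_tsupport ℝ fun h => hu (hball (hfU h))]
        rfl
    have h2 : ∀ u ∈ frontier Ω, f u = 0 := fun u hu =>
      image_eq_zero_of_notMem_tsupport fun h =>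
        (hΩ.isOpen.frontier_eq ▸ hu).2 (hball (hfU h))
    have h3 : ∫ u in frontier Ω, inner ℝ (outwardUnitNormal Ω u) e • f u ∂(μHE[2] : Measure E3)
        = 0 := setIntegral_eq_zero_of_forall_eq_zero fun u hu => by rw [h2 u hu, smul_zero]
    rw [h1, h3, sub_zero, norm_zero]
    have : 0 ≤ ∫ u in frontier Ω, ‖f u‖ ∂(μHE[2] : Measure E3) :=
      integral_nonneg fun _ => norm_nonneg _
    positivity
  · obtain ⟨r, hr, -, h⟩ := hΩ.exists_frontier_patch (F := F)
      (by rw [hΩ.isOpen.frontier_eq]; exact ⟨hp, hpΩ⟩) hε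
    exact ⟨r, hr, h⟩

/-- A finite `C¹` partition of unity on a compact set, subordinate to neighbourhoods of its
points. -/
theorem exists_contDiff_partition {K : Set E3} (hK : IsCompact K) {U : E3 → Set E3}
    (hUo : ∀ p ∈ K, IsOpen (U p)) (hU : ∀ p ∈ K, p ∈ U p) :
    ∃ (t : Finset E3) (χ : t → E3 → ℝ), (∀ i : t, (i : E3) ∈ K) ∧ (∀ i, ContDiff ℝ 1 (χ i)) ∧
      (∀ i u, 0 ≤ χ i u) ∧ (∀ u ∈ K, ∑ i, χ i u = 1) ∧ ∀ i, tsupport (χ i) ⊆ U i := by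
  obtain ⟨t, htK, ht⟩ := hK.elim_nhds_subcover U fun p hp => (hUo p hp).mem_nhds (hU p hp)
  obtain ⟨χ, hχ⟩ := SmoothPartitionOfUnity.exists_isSubordinate (modelWithCornersSelf ℝ E3)
    hK.isClosed (fun i : t => U i) (fun i => hUo i (htK i i.2)) (fun u hu => by
      obtain ⟨i, hi, hui⟩ := mem_iUnion₂.1 (ht hu)
      exact mem_iUnion.2 ⟨⟨i, hi⟩, hui⟩)
  refine ⟨t, fun i => χ i, fun i => htK i i.2, fun i => ?_, fun i u => χ.nonneg i u,
    fun u hu => ?_, hχ⟩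
  · exact (χ i).contMDiff.contDiff.of_le (by simp)
  · rw [← χ.sum_eq_one hu, finsum_eq_sum_of_fintype]

/-- The divergence theorem on a `C¹` domain, for one directional derivative.  The errors of the
patches add up to at most `ε ‖e‖ ∫ ‖f‖` over the boundary, with `ε` arbitrary. -/
theorem IsC1Domain.setIntegral_fderiv_eq_boundaryIntegral [CompleteSpace F] {Ω : Set E3}
    (hΩ : IsC1Domain Ω) {f : E3 → F} (hf : ∀ u ∈ closure Ω, ContDiffAt ℝ 1 f u) (e : E3) :
    ∫ u in Ω, fderiv ℝ f u e =
      boundaryIntegral Ω fun u => (inner ℝ (outwardUnitNormal Ω u) e : ℝ) • f u := by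
  have hfr : frontier Ω ⊆ closure Ω := frontier_subset_closure
  have hfc : ContinuousOn f (frontier Ω) := fun u hu =>
    (hf u (hfr hu)).continuousAt.continuousWithinAt
  set A := ∫ u in frontier Ω, ‖f u‖ ∂(μHE[2] : Measure E3)
  suffices h : ∀ ε > 0, ‖(∫ u in Ω, fderiv ℝ f u e) -
      boundaryIntegral Ω fun u => (inner ℝ (outwardUnitNormal Ω u) e : ℝ) • f u‖ ≤
      ε * ‖e‖ * A by
    have hlim : Tendsto (fun ε : ℝ => ε * ‖e‖ * A) (𝓝[>] 0) (𝓝 0) := by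
      have : Continuous fun ε : ℝ => ε * ‖e‖ * A := by fun_prop
      simpa using (this.tendsto 0).mono_left nhdsWithin_le_nhds
    have := ge_of_tendsto hlim (eventually_mem_nhdsWithin.mono h)
    exact sub_eq_zero.1 (norm_le_zero_iff.1 this)
  intro ε hε
  have hpatch : ∀ p, ∃ r, p ∈ closure Ω → 0 < r ∧ (∀ u ∈ Metric.ball p r, ContDiffAt ℝ 1 f u) ∧
      ∀ h : E3 → F, ContDiff ℝ 1 h → HasCompactSupport h → tsupport h ⊆ Metric.ball p r →
      ‖(∫ u in Ω, fderiv ℝ h u e) -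
          ∫ u in frontier Ω, inner ℝ (outwardUnitNormal Ω u) e • h u ∂(μHE[2] : Measure E3)‖ ≤
        ε * ‖e‖ * ∫ u in frontier Ω, ‖h u‖ ∂(μHE[2] : Measure E3) := by
    intro p
    by_cases hp : p ∈ closure Ω
    · obtain ⟨r₁, hr₁, h₁⟩ := hΩ.exists_patch (F := F) hp hε
      obtain ⟨r₂, hr₂, h₂⟩ := Metric.eventually_nhds_iff_ball.1 ((hf p hp).eventually (by simp))
      exact ⟨min r₁ r₂, fun _ => ⟨lt_min hr₁ hr₂,
        fun u hu => h₂ u (Metric.ball_subset_ball (min_le_right _ _) hu),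
        fun h hh hhc hhU => h₁ h hh hhc
          (hhU.trans (Metric.ball_subset_ball (min_le_left _ _))) e⟩⟩
    · exact ⟨0, fun h => absurd h hp⟩
  choose r hr using hpatch
  obtain ⟨t, χ, htK, hχd, hχ0, hχ1, hχU⟩ := exists_contDiff_partition
    hΩ.isBounded.isCompact_closure (U := fun p => Metric.ball p (r p))
    (fun _ _ => Metric.isOpen_ball) (fun p hp => Metric.mem_ball_self (hr p hp).1)
  set h : t → E3 → F := fun i u => χ i u • f u
  have hsupp : ∀ i, tsupport (h i) ⊆ tsupport (χ i) := fun i =>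
    tsupport_smul_subset_left (χ i) f
  have hhd : ∀ i, ContDiff ℝ 1 (h i) := fun i =>
    contDiff_of_forall_mem_tsupport fun u hu =>
      (hχd i).contDiffAt.smul ((hr i (htK i)).2.1 u (hχU i (hsupp i hu)))
  have hhc : ∀ i, HasCompactSupport (h i) := fun i =>
    Metric.isCompact_of_isClosed_isBounded (isClosed_tsupport _)
      (Metric.isBounded_ball.subset ((hsupp i).trans (hχU i)))
  have hest := fun i : t => (hr i (htK i)).2.2 (h i) (hhd i) (hhc i) ((hsupp i).trans (hχU i))
  have hsum : ∀ u ∈ closure Ω, f u = ∑ i, h i u := fun u hu => by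
    rw [← Finset.sum_smul, hχ1 u hu, one_smul]
  have hleft : ∫ u in Ω, fderiv ℝ f u e = ∑ i, ∫ u in Ω, fderiv ℝ (h i) u e := by
    rw [← integral_finsetSum]
    · refine setIntegral_congr_fun hΩ.isOpen.measurableSet fun u hu => ?_
      have he : f =ᶠ[𝓝 u] fun v => ∑ i, h i v := by
        filter_upwards [hΩ.isOpen.mem_nhds hu] with v hv using hsum v (subset_closure hv)
      rw [he.fderiv_eq, fderiv_fun_sum fun i _ => (hhd i).differentiable (by simp) u, sum_apply]
    · intro i _
      refine hΩ.isBounded.integrableOn_of_continuousAt_closure fun u _ => ?_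
      exact (((hhd i).continuous_fderiv (by simp)).clm_apply continuous_const).continuousAt
  have hnc : ContinuousOn (fun u => inner ℝ (outwardUnitNormal Ω u) e) (frontier Ω) :=
    hΩ.continuousOn_outwardUnitNormal.inner continuousOn_const
  have hright : boundaryIntegral Ω (fun u => (inner ℝ (outwardUnitNormal Ω u) e : ℝ) • f u) =
      ∑ i, ∫ u in frontier Ω, inner ℝ (outwardUnitNormal Ω u) e • h i u
        ∂(μHE[2] : Measure E3) := by
    rw [boundaryIntegral, ← integral_finsetSum]
    · refine setIntegral_congr_fun isClosed_frontier.measurableSet fun u hu => ?_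
      rw [hsum u (hfr hu), Finset.smul_sum]
    · exact fun i _ => hΩ.integrableOn_frontier (hnc.smul (hhd i).continuous.continuousOn)
  have hnorm : A = ∑ i, ∫ u in frontier Ω, ‖h i u‖ ∂(μHE[2] : Measure E3) := by
    rw [← integral_finsetSum]
    · refine setIntegral_congr_fun isClosed_frontier.measurableSet fun u hu => ?_
      simp only [h, norm_smul, Real.norm_eq_abs, abs_of_nonneg (hχ0 _ u)]
      rw [← Finset.sum_mul, hχ1 u (hfr hu), one_mul]
    · exact fun i _ => (hΩ.integrableOn_frontier (hhd i).continuous.continuousOn).norm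
  rw [hleft, hright, ← Finset.sum_sub_distrib, hnorm, Finset.mul_sum]
  exact norm_sum_le_of_le _ fun i _ => hest i

end divergence

/-! ### The spatial Reynolds transport theorem -/

theorem theorem1 {F : Type*} [NormedAddCommGroup F] [NormedSpace ℝ F] [FiniteDimensional ℝ F]
    (W : Set E3) (hW : IsOpen W)
    (D : E3 → Set E3) (hD : ∀ x ∈ W, IsC1Domain (D x))
    (b : E3 → E3 → F)
    (hb : ∀ x ∈ W, ∀ u ∈ closure (D x),
      ContDiffAt ℝ 1 (fun p : E3 × E3 => b p.1 p.2) (u, x))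
    (G : E3 → E3 → Matrix (Fin 3) (Fin 3) ℝ)
    (hG : ∀ x ∈ W, ∀ u ∈ closure (D x), ∀ i j,
      ContDiffAt ℝ 1 (fun p : E3 × E3 => G p.1 p.2 i j) (u, x))
    (x₀ : E3) (hx₀ : x₀ ∈ W) (φ : E3 → E3 → E3) (hφ : MovesDomain W D G x₀ φ)
    (x : E3) (hx : x ∈ W) :
    IntegrableOn (fun u => b u x) (D x) ∧
    (∀ i, IntegrableOn (fun u => gradX b u x i) (D x)) ∧
    (∀ i, IntegrableOn (fun u => flux b G (outwardUnitNormal (D x) u) u x i)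
      (frontier (D x)) (μHE[2] : Measure E3)) ∧
    (∀ i, IntegrableOn (fun u => divU b G u x i) (D x)) ∧
    HasFDerivAt (fun y => ∫ u in D y, b u y)
      (dotDx fun i => (∫ u in D x, gradX b u x i) +
        boundaryIntegral (D x) (fun u => flux b G (outwardUnitNormal (D x) u) u x i)) x ∧
    HasFDerivAt (fun y => ∫ u in D y, b u y)
      (dotDx fun i => ∫ u in D x, (gradX b u x i + divU b G u x i)) x := by
  have : CompleteSpace F := FiniteDimensional.complete ℝ F
  have hΩ := hD x hx
  have hslice : ∀ {Y : Type _} [TopologicalSpace Y] {h : E3 × E3 → Y} {u : E3},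
      ContinuousAt h (u, x) → ContinuousAt (fun v => h (v, x)) u := fun hc =>
    hc.comp (f := fun v => (v, x)) (Continuous.prodMk_left x).continuousAt
  have hbc : ∀ u ∈ closure (D x), ContDiffAt ℝ 1 (fun v => b v x) u := fun u hu =>
    (hb x hx u hu).comp (f := fun v => (v, x)) u (contDiffAt_id.prodMk contDiffAt_const)
  have hGc : ∀ u ∈ closure (D x), ∀ i j, ContDiffAt ℝ 1 (fun v => G v x i j) u :=
    fun u hu i j =>
      (hG x hx u hu i j).comp (f := fun v => (v, x)) u (contDiffAt_id.prodMk contDiffAt_const)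
  have hI₁ : IntegrableOn (fun u => b u x) (D x) :=
    hΩ.isBounded.integrableOn_of_continuousAt_closure fun u hu => (hbc u hu).continuousAt
  have hI₂ : ∀ i, IntegrableOn (fun u => gradX b u x i) (D x) := fun i =>
    hΩ.isBounded.integrableOn_of_continuousAt_closure fun u hu =>
      hslice (continuousAt_gradX (hb x hx u hu) i)
  have hI₄ : ∀ i, IntegrableOn (fun u => divU b G u x i) (D x) := fun i =>
    hΩ.isBounded.integrableOn_of_continuousAt_closure fun u hu =>
      hslice (continuousAt_divU (hb x hx u hu) (hG x hx u hu) i)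
  have hterm : ∀ i j, IntegrableOn
      (fun u => (inner ℝ (outwardUnitNormal (D x) u) (unitVec j) : ℝ) • (G u x i j • b u x))
      (frontier (D x)) (μHE[2] : Measure E3) := fun i j =>
    hΩ.integrableOn_frontier ((hΩ.continuousOn_outwardUnitNormal.inner continuousOn_const).smul
      fun u hu => ((hGc u (frontier_subset_closure hu) i j).smul
        (hbc u (frontier_subset_closure hu))).continuousAt.continuousWithinAt)
  have hflux : ∀ i, (fun u => flux b G (outwardUnitNormal (D x) u) u x i) =
      fun u => ∑ j, (inner ℝ (outwardUnitNormal (D x) u) (unitVec j) : ℝ) •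
        (G u x i j • b u x) := by
    intro i
    ext1 u
    rw [flux, Finset.sum_smul]
    refine Finset.sum_congr rfl fun j _ => ?_
    rw [smul_smul, EuclideanSpace.inner_single_right]
    simp [mul_comm]
  have hI₃ : ∀ i, IntegrableOn (fun u => flux b G (outwardUnitNormal (D x) u) u x i)
      (frontier (D x)) (μHE[2] : Measure E3) := fun i => by
    rw [hflux i]
    exact integrable_finsetSum _ fun j _ => hterm i j
  have hdiv : ∀ i, ∫ u in D x, divU b G u x i =
      boundaryIntegral (D x) fun u => flux b G (outwardUnitNormal (D x) u) u x i := by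
    intro i
    unfold divU
    rw [hflux i, boundaryIntegral, integral_finsetSum _ fun j _ => hterm i j, integral_finsetSum]
    · refine Finset.sum_congr rfl fun j _ => ?_
      exact hΩ.setIntegral_fderiv_eq_boundaryIntegral
        (fun u hu => (hGc u hu i j).smul (hbc u hu)) (unitVec j)
    · intro j _
      refine hΩ.isBounded.integrableOn_of_continuousAt_closure fun u hu => ?_
      exact ((((hGc u hu i j).smul (hbc u hu)).continuousAt_fderiv (by simp)).clm_apply
        continuousAt_const)
  have hmain := hφ.hasFDerivAt_setIntegral hW (hD x₀ hx₀).isOpen (hD x₀ hx₀).isBounded hb hG hx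
  rw [integral_dotDx (c := fun u i => gradX b u x i + divU b G u x i)
    fun i => (hI₂ i).add (hI₄ i)] at hmain
  refine ⟨hI₁, hI₂, hI₃, hI₄, ?_, hmain⟩
  simp_rw [← hdiv, ← integral_add (hI₂ _) (hI₄ _)]
  exact hmain
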